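/- Let $k\ge 1$ be an integer. **Branching process.** Let $(\mathbb T_k,\rho)$ be the family tree of the multi-type branching process with types $\mathfrak a$-even, $\mathfrak b$-even, $\mathfrak a$-odd, $\mathfrak b$-odd, whose root $\rho$ has type $\mathfrak a$-even and in which, with all Poisson variables independent: an $\mathfrak a$-even particle has one $\mathfrak a$-odd child and $\mathrm{Poisson}(k)$ many $\mathfrak b$-odd children; a $\mathfrak b$-even particle has $\mathrm{Poisson}(k)$ many $\mathfrak b$-odd children; an $\mathfrak a$-odd particle has $k$ children, all $\mathfrak a$-even; a $\mathfrak b$-odd particle has $k-1$ $\mathfrak a$-even children and one $\mathfrak b$-even child. **1-out model.** For $d\ge1$ let $\mathbf T=\mathbf T_{k,d}$ be the infinite tree with root $\mathbf v$ in which every vertex at even distance from $\mathbf v$ has $d$ children and every vertex at odd distance has $k$ children. Each vertex $v$ at even distance independently draws a uniformly random vertex $u_v$ among all its neighbours (its children and, if $v\ne\mathbf v$, its parent). Let $\mathcal O$ be the set of all drawn vertices, and let $\mathbf T[\mathcal O]$ be the subgraph of $\mathbf T$ induced by $\mathcal O$ together with all vertices at even distance from $\mathbf v$. **Trees.** For a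 graph $G$ with a vertex $x$, $B_G(x,r)$ denotes the subgraph of $G$ induced by the vertices at graph distance at most $r$ from $x$, rooted at $x$; $\cong$ denotes root-preserving graph isomorphism, and $B_{\mathcal O}(\mathbf v,r)=B_{\mathbf T[\mathcal O]}(\mathbf v,r)$. Let $(T,o)$ be a finite rooted tree. The height of a vertex is its distance from $o$, and the height of $T$ is the maximal height of a vertex. Call $(T,o)$ valid if its height is even and every vertex of odd height has degree $k+1$. Let $U(T)$ be the set of vertices of odd height, $I(T)$ the set of vertices of even height strictly smaller than the height of $T$, $m(I(T),T)$ the number of matchings of $T$ in which all vertices of $I(T)\cup U(T)$ are saturated, and $\mathrm{Aut}(T,o)$ the group of automorphisms of $T$ fixing $o$. **Claim.** For every valid finite rooted tree $(T,o)$ of height $r\ge0$, $$P\big(B_{\mathbb T_k}(\rho,r)\cong(T,o)\big)=\lim_{d\to\infty}P\big(B_{\mathcal O}(\mathbf v,r)\cong(T,o)\big)=\frac{e^{-k|I(T)|}\,(k!)^{|U(T)|}\,m(I(T),T)}{|\mathrm{Aut}(T,o)|}$$ (in particular the limit exists). -/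

import Mathlib

open MeasureTheory ProbabilityTheory Filter Topology

namespace LocalLimit

/-! ### Rooted graphs, balls and valid trees -/

section Rooted

variable {α β : Type*}

/-- The vertices at graph distance at most `r` from `x`. The extended distance is used, so that
vertices outside the component of `x` (at distance `⊤`) are excluded. -/
def ball (G : SimpleGraph α) (x : α) (r : ℕ) : Set α :=
  {y | G.edist x y ≤ (r : ℕ∞)}

theorem mem_ball_self (G : SimpleGraph α) (x : α) (r : ℕ) : x ∈ ball G x r := by
  simp [ball]

/-- `B_G(x, r) ≅ (T, o)`: the subgraph of `G` induced on the ball of radius `r` around `x`,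
rooted at `x`, is isomorphic to `(T, o)` by a root preserving graph isomorphism. -/
def BallIso (G : SimpleGraph α) (x : α) (r : ℕ) (T : SimpleGraph β) (o : β) : Prop :=
  ∃ φ : G.induce (ball G x r) ≃g T, φ ⟨x, mem_ball_self G x r⟩ = o

/-- The height of a finite rooted tree: the maximal distance of a vertex from the root. -/
noncomputable def height [Fintype α] (T : SimpleGraph α) (o : α) : ℕ :=
  Finset.univ.sup (T.dist o)

/-- `U(T)`: the vertices of odd height. -/
def oddVerts (T : SimpleGraph α) (o : α) : Set α :=
  {v | Odd (T.dist o v)}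

/-- `I(T)`: the vertices of even height strictly smaller than the height of the tree. -/
def innerEvenVerts [Fintype α] (T : SimpleGraph α) (o : α) : Set α :=
  {v | Even (T.dist o v) ∧ T.dist o v < height T o}

/-- A finite rooted tree is valid (with parameter `k`) if its height is even and every vertex of
odd height has degree `k + 1`. -/
structure IsValid [Fintype α] (k : ℕ) (T : SimpleGraph α) (o : α) : Prop where
  isTree : T.IsTree
  even_height : Even (height T o)
  degree_odd : ∀ v ∈ oddVerts T o, (T.neighborSet v).ncard = k + 1

/-- `m(K, T)`: the number of matchings of `T` in which all vertices of `K ∪ U(T)` are saturated.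
A matching is a subgraph in which every vertex has exactly one neighbour, so its vertices are
precisely the saturated ones. -/
noncomputable def numMatchings (T : SimpleGraph α) (o : α) (K : Set α) : ℕ :=
  {M : T.Subgraph | M.IsMatching ∧ K ∪ oddVerts T o ⊆ M.verts}.ncard

/-- `|Aut(T, o)|`: the number of root preserving automorphisms. -/
noncomputable def numAut (T : SimpleGraph α) (o : α) : ℕ :=
  {φ : T ≃g T | φ o = o}.ncard

/-- `e^{-k|I(T)|} (k!)^{|U(T)|} m(I(T), T) / |Aut(T, o)|`. -/
noncomputable def ballFormula [Fintype α] (k : ℕ) (T : SimpleGraph α) (o : α) : ℝ :=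
  Real.exp (-((k : ℝ) * ((innerEvenVerts T o).ncard : ℝ)))
    * (k.factorial : ℝ) ^ (oddVerts T o).ncard
    * (numMatchings T o (innerEvenVerts T o) : ℝ) / (numAut T o : ℝ)

end Rooted

/-! ### The multi-type branching process `𝕋_k` -/

/-- The four types of particles. -/
inductive ParticleType
  | aEven
  | bEven
  | aOdd
  | bOdd

/-- The list of the types of the children of a particle, given its type and the value `n` of
the Poisson variable attached to it (which only the even types use). -/
def offspring (k : ℕ) : ParticleType → ℕ → List ParticleType
  | .aEven, n => .aOdd :: List.replicate n .bOdd
  | .bEven, n => List.replicate n .bOdd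
  | .aOdd, _ => List.replicate k .aEven
  | .bOdd, _ => .bEven :: List.replicate (k - 1) .aEven

/-- Potential particles are words of natural numbers: `[]` is the root and `i :: w` is the `i`-th
child of `w`. Given the values `ω` of all Poisson variables, `particleType k ω w` is the type of the
particle `w`, or `none` if there is no such particle. The root has type `aEven`. -/
def particleType (k : ℕ) (ω : List ℕ → ℕ) : List ℕ → Option ParticleType
  | [] => some .aEven
  | i :: w => (particleType k ω w).bind fun t => (offspring k t (ω w))[i]?

/-- The tree on all words, in which each `w` is joined to its children `i :: w`. -/
def wordTree : SimpleGraph (List ℕ) :=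
  SimpleGraph.fromRel fun w w' => ∃ i, w' = i :: w

/-- The set of particles that are born. -/
def particles (k : ℕ) (ω : List ℕ → ℕ) : Set (List ℕ) :=
  {w | (particleType k ω w).isSome}

theorem nil_mem_particles (k : ℕ) (ω : List ℕ → ℕ) : [] ∈ particles k ω := rfl

/-- The family tree of the branching process. -/
def branchingTree (k : ℕ) (ω : List ℕ → ℕ) : SimpleGraph (particles k ω) :=
  wordTree.induce (particles k ω)

/-- The root `ρ` of the family tree. -/
def branchingRoot (k : ℕ) (ω : List ℕ → ℕ) : particles k ω :=
  ⟨[], nil_mem_particles k ω⟩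

/-- The law of the independent `Poisson(k)` variables, one for each word. -/
noncomputable def poissonLaw (k : ℕ) : Measure (List ℕ → ℕ) :=
  Measure.infinitePi fun _ : List ℕ => poissonMeasure (k : NNReal)

/-- `P(B_{𝕋_k}(ρ, r) ≅ (T, o))`. -/
noncomputable def branchingBallProb {β : Type*} (k r : ℕ) (T : SimpleGraph β) (o : β) : ℝ :=
  (poissonLaw k).real {ω | BallIso (branchingTree k ω) (branchingRoot k ω) r T o}

/-! ### The 1-out model on the infinite tree `𝐓_{k,d}` -/

/-- The vertices of even height of `𝐓_{k,d}`: `[]` is the root `𝐯`, and `(i, j) :: w` is the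
`j`-th child of the `i`-th child of `w`. -/
abbrev EvenVertex (k d : ℕ) : Type := List (Fin d × Fin k)

/-- The vertices of odd height of `𝐓_{k,d}`: `⟨w, i⟩` is the `i`-th child of `w`. -/
@[ext]
structure OddVertex (k d : ℕ) : Type where
  parent : EvenVertex k d
  index : Fin d

/-- `IsChild x y` says that `y` is a child of `x` in `𝐓_{k,d}`. -/
def IsChild {k d : ℕ} : EvenVertex k d ⊕ OddVertex k d → EvenVertex k d ⊕ OddVertex k d → Prop
  | .inl w, .inr u => u.parent = w
  | .inr u, .inl w => ∃ j, w = (u.index, j) :: u.parent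
  | _, _ => False

/-- The infinite tree `𝐓_{k,d}` with root `.inl []`, in which vertices of even height have `d`
children and vertices of odd height have `k` children. -/
def bigTree (k d : ℕ) : SimpleGraph (EvenVertex k d ⊕ OddVertex k d) :=
  SimpleGraph.fromRel IsChild

/-- The neighbours in `𝐓_{k,d}` of a vertex of even height (all of which have odd height). -/
def evenNbrs {k d : ℕ} (v : EvenVertex k d) : Set (OddVertex k d) :=
  {u | (bigTree k d).Adj (.inl v) (.inr u)}

instance instMeasurableSpaceOddVertex (k d : ℕ) : MeasurableSpace (OddVertex k d) := ⊤

instance instDiscreteMeasurableSpaceOddVertex (k d : ℕ) :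
    DiscreteMeasurableSpace (OddVertex k d) := ⟨fun _ => trivial⟩

theorem mem_evenNbrs {k d : ℕ} (v : EvenVertex k d) (u : OddVertex k d) :
    u ∈ evenNbrs v ↔ u.parent = v ∨ ∃ j, v = (u.index, j) :: u.parent := by
  simp [evenNbrs, bigTree, IsChild]

theorem evenNbrs_finite {k d : ℕ} (v : EvenVertex k d) : (evenNbrs v).Finite := by
  refine ((Set.finite_range fun i : Fin d => (⟨v, i⟩ : OddVertex k d)).union
    (Set.finite_range fun i : Fin d => (⟨v.tail, i⟩ : OddVertex k d))).subset ?_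
  intro u hu
  rcases (mem_evenNbrs v u).1 hu with h | ⟨j, h⟩
  · exact Or.inl ⟨u.index, by ext1 <;> simp [h]⟩
  · exact Or.inr ⟨u.index, by ext1 <;> simp [h]⟩

theorem evenNbrs_nonempty {k d : ℕ} [NeZero d] (v : EvenVertex k d) : (evenNbrs v).Nonempty :=
  ⟨⟨v, 0⟩, (mem_evenNbrs v _).2 (Or.inl rfl)⟩

instance instIsProbabilityMeasureUniformOnEvenNbrs {k d : ℕ} [NeZero d] (v : EvenVertex k d) :
    IsProbabilityMeasure (uniformOn (evenNbrs v)) :=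
  isProbabilityMeasure_uniformOn (evenNbrs_finite v) (evenNbrs_nonempty v)

/-- The joint law of the draws `v ↦ u_v`: independently for each vertex `v` of even height,
`u_v` is uniformly distributed on the neighbours of `v`. -/
noncomputable def drawLaw (k d : ℕ) [NeZero d] : Measure (EvenVertex k d → OddVertex k d) :=
  Measure.infinitePi fun v : EvenVertex k d => uniformOn (evenNbrs v)

/-- The vertex set of `𝐓[𝒪]`: all vertices of even height together with `𝒪 = {u_v}`. -/
def oneOutVerts {k d : ℕ} (ω : EvenVertex k d → OddVertex k d) :
    Set (EvenVertex k d ⊕ OddVertex k d) :=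
  Set.range Sum.inl ∪ Sum.inr '' Set.range ω

/-- The random graph `𝐓[𝒪]`. -/
def oneOutGraph {k d : ℕ} (ω : EvenVertex k d → OddVertex k d) :
    SimpleGraph (oneOutVerts ω) :=
  (bigTree k d).induce (oneOutVerts ω)

/-- The root `𝐯` as a vertex of `𝐓[𝒪]`. -/
def oneOutRoot {k d : ℕ} (ω : EvenVertex k d → OddVertex k d) : oneOutVerts ω :=
  ⟨.inl [], Or.inl ⟨[], rfl⟩⟩

/-- `P(B_𝒪(𝐯, r) ≅ (T, o))` in the 1-out model on `𝐓_{k,d}`, for `d ≥ 1`. -/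
noncomputable def oneOutBallProb {β : Type*} (k d : ℕ) [NeZero d] (r : ℕ)
    (T : SimpleGraph β) (o : β) : ℝ :=
  (drawLaw k d).real {ω | BallIso (oneOutGraph ω) (oneOutRoot ω) r T o}

end LocalLimit

/-! Both probabilities are computed by counting embeddings. If the ball is isomorphic to `(T, o)`,
there are exactly `|Aut(T, o)|` parent-preserving embeddings of `T` onto it
(`ncard_isBallEmbedding`). Hence `|Aut(T, o)| * P(ball ≅ T)` is the sum, over embeddings `ψ` into
the ambient tree, of the probability that `ψ` is onto the ball (`nsmul_measureReal_eq_sum`).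

Branching process: types encode a matching. An a-even particle is matched to its a-odd child and a
b-odd particle to its b-even child, so a-odd and b-even mean "matched to the parent". A matching
saturating all vertices below the top level is coded by the set `C` of lower ends of its edges. Let
`m v` be the number of children of `v` outside `C`. For fixed `C` there are `∏ (m v)!` plane
embeddings, each of probability `∏ e^{-k} k^{m v} / (m v)!` over the inner even vertices. The
factorials at even vertices cancel. The powers of `k` give one factor `k` for each odd vertex
outside `C`, which turns its `(k-1)!` into `k!`. So every matching contributes `e^{-k|I|}
(k!)^{|U|}` (`prod_factorial_mul_prod_poisson`).

1-out model: there are about `d^{|U|} (k!)^{|U|}` embeddings into the big tree. For one of them to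
be the ball, the roughly `|I| d k` grandchildren of inner even vertices through odd vertices outside
the image must not draw their parents, which tends to `e^{-k|I|}`. Moreover the even vertices of the
image must draw all its odd vertices, and the inner ones nothing else. Each prescribed draw costs
about `1/d`, so after multiplication by `d^{|U|}` only patterns with exactly `|U|` draws survive,
and these are the matchings (`tendsto_pow_mul_prod_optDrawProb`). -/

namespace LocalLimit

/-! ### Rooted forests given by parent and depth functions -/

/-- `G` is a forest in which the parent of every vertex other than `ρ` is given by `p`, and the
depth of the vertices by `d`. -/
structure IsRooted {V : Type*} (G : SimpleGraph V) (ρ : V) (p : V → V) (d : V → ℕ) : Prop where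
  depth_root : d ρ = 0
  depth_eq : ∀ v, v ≠ ρ → d v = d (p v) + 1
  adj_iff : ∀ u v, G.Adj u v ↔ (v ≠ ρ ∧ u = p v) ∨ (u ≠ ρ ∧ v = p u)

namespace IsRooted

variable {V : Type*} {G : SimpleGraph V} {ρ : V} {p : V → V} {d : V → ℕ}

theorem depth_eq_zero_iff (h : IsRooted G ρ p d) {v : V} : d v = 0 ↔ v = ρ := by
  refine ⟨fun hv => ?_, fun hv => hv ▸ h.depth_root⟩
  by_contra hne
  have := h.depth_eq v hne
  omega

theorem ne_root_of_depth (h : IsRooted G ρ p d) {v : V} (hv : d v ≠ 0) : v ≠ ρ :=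
  fun e => hv (h.depth_eq_zero_iff.2 e)

theorem adj_parent (h : IsRooted G ρ p d) {v : V} (hv : v ≠ ρ) : G.Adj v (p v) :=
  (h.adj_iff _ _).2 (Or.inr ⟨hv, rfl⟩)

/-- Induction from parents to children. -/
theorem induction (h : IsRooted G ρ p d) {P : V → Prop} (root : P ρ)
    (step : ∀ v, v ≠ ρ → P (p v) → P v) (v : V) : P v := by
  induction hn : d v using Nat.strong_induction_on generalizing v with
  | _ n ih =>
    by_cases hv : v = ρ
    · exact hv ▸ root
    · have := h.depth_eq v hv
      exact step v hv (ih (d (p v)) (by omega) _ rfl)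

end IsRooted

/-- A tree is rooted at each of its vertices, with the distance as depth. -/
theorem exists_isRooted {V : Type*} {T : SimpleGraph V} (hT : T.IsTree) (o : V) :
    ∃ p : V → V, IsRooted T o p (T.dist o) := by
  classical
  have key : ∀ v, ∃ u, v ≠ o → T.Adj u v ∧ T.dist o v = T.dist o u + 1 ∧
      ∀ w, T.Adj w v → T.dist o v = T.dist o w + 1 → w = u := by
    intro v
    by_cases hv : v = o
    · exact ⟨v, fun h => absurd hv h⟩
    obtain ⟨q, hq, hlen⟩ := hT.connected.exists_path_of_dist o v
    have hnil : ¬ q.Nil := fun hn => hv hn.eq.symm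
    have huniq : ∀ w, T.Adj w v → T.dist o v = T.dist o w + 1 → w = q.penultimate := by
      intro w hw hd
      obtain ⟨p, hp, hplen⟩ := hT.connected.exists_path_of_dist o w
      apply hT.isAcyclic.eq_penultimate_of_adj_end hq hw.symm
      -- A geodesic to `w` misses `v`, which is farther from `o`; acyclicity then forces `w` onto
      -- the path to `v`, as its last vertex before `v`.
      have hvp : v ∉ p.support := by
        intro hmem
        have h1 := T.dist_le (p.takeUntil v hmem)
        have h2 := p.length_takeUntil_le_length hmem
        omega
      exact hT.isAcyclic.mem_support_of_ne_mem_support_of_adj_of_isPath hq hp hw.symm hvp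
    refine ⟨q.penultimate, fun _ => ⟨q.adj_penultimate hnil, ?_, huniq⟩⟩
    rcases hT.dist_eq_dist_add_one_of_adj o (q.adj_penultimate hnil) with h | h
    · exfalso
      have h1 := T.dist_le q.dropLast
      have h2 : q.dropLast.length = q.length - 1 := by simp
      omega
    · exact h
  choose p hp using key
  refine ⟨p, by simp, fun v hv => (hp v hv).2.1, fun u v => ⟨fun huv => ?_, ?_⟩⟩
  · rcases hT.dist_eq_dist_add_one_of_adj o huv with h | h
    · have hu : u ≠ o := by rintro rfl; simp at h
      exact Or.inr ⟨hu, (hp u hu).2.2 v huv.symm h⟩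
    · have hv : v ≠ o := by rintro rfl; simp at h
      exact Or.inl ⟨hv, (hp v hv).2.2 u huv h⟩
  · rintro (⟨hv, rfl⟩ | ⟨hu, rfl⟩)
    · exact (hp v hv).1
    · exact (hp u hu).1.symm

/-- `ψ` maps the root to the root and commutes with taking parents. -/
structure IsRootedMap {α V : Type*} (o : α) (par : α → α) (ρ : V) (p : V → V) (ψ : α → V) :
    Prop where
  map_root : ψ o = ρ
  map_ne : ∀ v, v ≠ o → ψ v ≠ ρ
  map_parent : ∀ v, v ≠ o → p (ψ v) = ψ (par v)

theorem IsRootedMap.depth {α V : Type*} {T : SimpleGraph α} {o : α} {par : α → α} {ht : α → ℕ}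
    {G : SimpleGraph V} {ρ : V} {p : V → V} {d : V → ℕ} {ψ : α → V}
    (hψ : IsRootedMap o par ρ p ψ) (hT : IsRooted T o par ht) (hG : IsRooted G ρ p d) (v : α) :
    d (ψ v) = ht v := by
  induction v using hT.induction with
  | root => rw [hψ.map_root, hG.depth_root, hT.depth_root]
  | step v hv ih => rw [hG.depth_eq _ (hψ.map_ne v hv), hψ.map_parent v hv, ih, hT.depth_eq v hv]

/-- The embeddings of the rooted tree on `α` (of height at most `r`) onto the ball of radius `r` of
the subgraph induced on `S`. -/
structure IsBallEmbedding {α V : Type*} (o : α) (par : α → α) (ht : α → ℕ) (ρ : V) (p : V → V)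
    (S : Set V) (r : ℕ) (ψ : α → V) : Prop where
  isRootedMap : IsRootedMap o par ρ p ψ
  injective : Function.Injective ψ
  mem : ∀ v, ψ v ∈ S
  full : ∀ v, ht v < r → ∀ y ∈ S, y ≠ ρ → p y = ψ v → y ∈ Set.range ψ

/-! ### Ball isomorphisms as embeddings, and their number -/

section Ball

variable {α V : Type*} {T : SimpleGraph α} {o : α} {par : α → α} {ht : α → ℕ}
  {G : SimpleGraph V} {ρ : V} {p : V → V} {d : V → ℕ} {S : Set V} {r : ℕ}

theorem edist_le_of_isRootedMap (hT : IsRooted T o par ht) (hG : IsRooted G ρ p d) {ψ : α → V}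
    (hψ : IsRootedMap o par ρ p ψ) (hmem : ∀ v, ψ v ∈ S) (hρ : ρ ∈ S) (v : α) :
    (G.induce S).edist ⟨ρ, hρ⟩ ⟨ψ v, hmem v⟩ ≤ (ht v : ℕ∞) := by
  induction v using hT.induction with
  | root =>
    have : (⟨ψ o, hmem o⟩ : S) = ⟨ρ, hρ⟩ := Subtype.ext hψ.map_root
    rw [this]; simp
  | step v hv ih =>
    have hadj : (G.induce S).Adj ⟨ψ (par v), hmem _⟩ ⟨ψ v, hmem _⟩ := by
      have := (hG.adj_parent (hψ.map_ne v hv)).symm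
      rw [hψ.map_parent v hv] at this
      exact this
    calc _ ≤ _ := SimpleGraph.edist_triangle (v := ⟨ψ (par v), hmem _⟩)
      _ ≤ (ht (par v) : ℕ∞) + 1 :=
        add_le_add ih (SimpleGraph.edist_eq_one_iff_adj.2 hadj).le
      _ = (ht v : ℕ∞) := by rw [hT.depth_eq v hv]; push_cast; rfl

/-- A walk from the image cannot leave it within its height budget: a step down is caught by `full`,
which applies because steps remain, and a step up lands on the image of the parent. -/
theorem IsBallEmbedding.mem_range_of_walk (hG : IsRooted G ρ p d) (hT : IsRooted T o par ht)
    {ψ : α → V} (hψ : IsBallEmbedding o par ht ρ p S r ψ) {x y : S} (w : (G.induce S).Walk x y)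
    (v : α) (hv : ψ v = x) (hr : ht v + w.length ≤ r) : (y : V) ∈ Set.range ψ := by
  induction w generalizing v with
  | nil => exact ⟨v, hv⟩
  | @cons x z y hadj w ih =>
    rw [SimpleGraph.Walk.length_cons] at hr
    have hxz : G.Adj x z := hadj
    rcases (hG.adj_iff _ _).1 hxz with ⟨hz, hx⟩ | ⟨hx, hz⟩
    · obtain ⟨v', hv'⟩ := hψ.full v (by omega) z z.2 hz (by rw [hv, hx])
      have hne : v' ≠ o := by
        rintro rfl
        exact hz (hv' ▸ hψ.isRootedMap.map_root)
      have hpar : par v' = v := hψ.injective <| by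
        rw [← hψ.isRootedMap.map_parent v' hne, hv', hv, hx]
      have := hT.depth_eq v' hne
      rw [hpar] at this
      exact ih v' hv' (by omega)
    · have hne : v ≠ o := by
        rintro rfl
        exact hx (hv ▸ hψ.isRootedMap.map_root)
      have := hT.depth_eq v hne
      exact ih (par v) (by rw [← hψ.isRootedMap.map_parent v hne, hv, hz]) (by omega)

theorem mem_ball_iff_of_isBallEmbedding (hG : IsRooted G ρ p d) (hT : IsRooted T o par ht)
    (hr : ∀ v, ht v ≤ r) (hρ : ρ ∈ S) {ψ : α → V} (hψ : IsBallEmbedding o par ht ρ p S r ψ)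
    (y : S) : y ∈ ball (G.induce S) ⟨ρ, hρ⟩ r ↔ (y : V) ∈ Set.range ψ := by
  constructor
  · intro hy
    have hy : (G.induce S).edist ⟨ρ, hρ⟩ y ≤ r := hy
    have hne : (G.induce S).edist ⟨ρ, hρ⟩ y ≠ ⊤ := fun e => by simp [e] at hy
    obtain ⟨w, hw⟩ := SimpleGraph.exists_walk_of_edist_ne_top hne
    refine hψ.mem_range_of_walk hG hT w o hψ.isRootedMap.map_root ?_
    rw [← hw] at hy
    rw [hT.depth_root, zero_add]
    exact_mod_cast hy
  · rintro ⟨v, hv⟩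
    have := edist_le_of_isRootedMap hT hG hψ.isRootedMap hψ.mem hρ v
    have h2 : (⟨ψ v, hψ.mem v⟩ : S) = y := Subtype.ext hv
    rw [h2] at this
    exact this.trans (by exact_mod_cast hr v)

theorem adj_iff_of_isRootedMap (hG : IsRooted G ρ p d) (hT : IsRooted T o par ht) {ψ : α → V}
    (hψ : IsRootedMap o par ρ p ψ) (hinj : Function.Injective ψ) (u v : α) :
    G.Adj (ψ u) (ψ v) ↔ T.Adj u v := by
  have hne : ∀ v, ψ v ≠ ρ ↔ v ≠ o := fun v =>
    ⟨fun h e => h (e ▸ hψ.map_root), hψ.map_ne v⟩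
  rw [hG.adj_iff, hT.adj_iff, hne, hne]
  have h1 : ∀ u v, (v ≠ o ∧ ψ u = p (ψ v)) ↔ (v ≠ o ∧ u = par v) := fun u v =>
    and_congr_right fun hv => by rw [hψ.map_parent v hv, hinj.eq_iff]
  rw [h1, h1]

theorem exists_iso_of_isBallEmbedding (hG : IsRooted G ρ p d) (hT : IsRooted T o par ht)
    (hr : ∀ v, ht v ≤ r) (hρ : ρ ∈ S) {ψ : α → V} (hψ : IsBallEmbedding o par ht ρ p S r ψ) :
    ∃ φ : (G.induce S).induce (ball (G.induce S) ⟨ρ, hρ⟩ r) ≃g T,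
      φ ⟨⟨ρ, hρ⟩, mem_ball_self _ _ _⟩ = o ∧ ∀ v, ((φ.symm v).1 : V) = ψ v := by
  let f : α → ball (G.induce S) ⟨ρ, hρ⟩ r := fun v =>
    ⟨⟨ψ v, hψ.mem v⟩, (mem_ball_iff_of_isBallEmbedding hG hT hr hρ hψ _).2 ⟨v, rfl⟩⟩
  have hf : Function.Bijective f := by
    constructor
    · intro u v huv
      exact hψ.injective (congrArg (fun x => (x.1 : V)) huv)
    · intro y
      obtain ⟨v, hv⟩ := (mem_ball_iff_of_isBallEmbedding hG hT hr hρ hψ y.1).1 y.2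
      exact ⟨v, Subtype.ext (Subtype.ext hv)⟩
  let e : T ≃g (G.induce S).induce (ball (G.induce S) ⟨ρ, hρ⟩ r) :=
    { Equiv.ofBijective f hf with
      map_rel_iff' := fun {u v} =>
        adj_iff_of_isRootedMap hG hT hψ.isRootedMap hψ.injective u v }
  refine ⟨e.symm, ?_, fun v => rfl⟩
  have : e o = ⟨⟨ρ, hρ⟩, mem_ball_self _ _ _⟩ :=
    Subtype.ext (Subtype.ext hψ.isRootedMap.map_root)
  rw [← this]
  exact e.symm_apply_apply o

/-- An isomorphism is only known to preserve adjacency and the root. That it preserves parents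
follows by induction from the root, and fullness holds because children of vertices of height less
than `r` are still in the ball. -/
theorem isBallEmbedding_of_iso (hG : IsRooted G ρ p d) (hT : IsRooted T o par ht) (hρ : ρ ∈ S)
    (φ : (G.induce S).induce (ball (G.induce S) ⟨ρ, hρ⟩ r) ≃g T)
    (hφ : φ ⟨⟨ρ, hρ⟩, mem_ball_self _ _ _⟩ = o) :
    IsBallEmbedding o par ht ρ p S r (fun v => ((φ.symm v).1 : V)) := by
  have hinj : Function.Injective (fun v => ((φ.symm v).1 : V)) := fun u v huv =>
    φ.symm.injective (Subtype.ext (Subtype.ext huv))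
  have hroot : ((φ.symm o).1 : V) = ρ := by
    rw [← hφ, φ.symm_apply_apply]
  have hne : ∀ v, v ≠ o → ((φ.symm v).1 : V) ≠ ρ := fun v hv e =>
    hv (hinj (e.trans hroot.symm))
  have hpar : ∀ v, v ≠ o → p ((φ.symm v).1 : V) = ((φ.symm (par v)).1 : V) := by
    intro v
    induction v using hT.induction with
    | root => exact fun h => absurd rfl h
    | step v hv ih =>
      intro _
      have hadj : G.Adj ((φ.symm v).1 : V) ((φ.symm (par v)).1 : V) :=
        φ.symm.map_rel_iff.2 (hT.adj_parent hv)
      -- If the edge pointed the wrong way, the image of `par v` would have both `v` and `par (par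
      -- v)` as its parent, contradicting the depths.
      rcases (hG.adj_iff _ _).1 hadj with ⟨h1, h2⟩ | ⟨h1, h2⟩
      · have hpo : par v ≠ o := by
          intro e
          rw [e] at h1
          exact h1 hroot
        rw [ih hpo] at h2
        have e := hinj h2
        have e1 := hT.depth_eq v hv
        have e2 := hT.depth_eq _ hpo
        rw [← e] at e2
        omega
      · exact h2.symm
  have hmap : IsRootedMap o par ρ p (fun v => ((φ.symm v).1 : V)) := ⟨hroot, hne, hpar⟩
  refine ⟨hmap, hinj, fun v => (φ.symm v).1.2, ?_⟩
  intro v hv y hy hyρ hpy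
  have hb : (⟨y, hy⟩ : S) ∈ ball (G.induce S) ⟨ρ, hρ⟩ r := by
    have h1 := edist_le_of_isRootedMap hT hG hmap (fun v => (φ.symm v).1.2) hρ v
    have hadj : (G.induce S).Adj (φ.symm v).1 ⟨y, hy⟩ := by
      have := (hG.adj_parent hyρ).symm
      rw [hpy] at this
      exact this
    calc _ ≤ _ := SimpleGraph.edist_triangle (v := (φ.symm v).1)
      _ ≤ (ht v : ℕ∞) + 1 := add_le_add h1 (SimpleGraph.edist_eq_one_iff_adj.2 hadj).le
      _ ≤ (r : ℕ∞) := by exact_mod_cast hv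
  exact ⟨φ ⟨⟨y, hy⟩, hb⟩, congrArg (fun x => (x.1 : V)) (φ.symm_apply_apply _)⟩

theorem ballIso_iff_exists_isBallEmbedding (hG : IsRooted G ρ p d) (hT : IsRooted T o par ht)
    (hr : ∀ v, ht v ≤ r) (hρ : ρ ∈ S) :
    BallIso (G.induce S) ⟨ρ, hρ⟩ r T o ↔ ∃ ψ, IsBallEmbedding o par ht ρ p S r ψ := by
  constructor
  · rintro ⟨φ, hφ⟩
    exact ⟨_, isBallEmbedding_of_iso hG hT hρ φ hφ⟩
  · rintro ⟨ψ, hψ⟩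
    obtain ⟨φ, hφ, -⟩ := exists_iso_of_isBallEmbedding hG hT hr hρ hψ
    exact ⟨φ, hφ⟩

/-- The embeddings form a torsor under the automorphism group: composing one fixed inverse
isomorphism with the automorphisms yields each embedding exactly once. -/
theorem ncard_isBallEmbedding (hG : IsRooted G ρ p d) (hT : IsRooted T o par ht)
    (hr : ∀ v, ht v ≤ r) (hρ : ρ ∈ S) (h : BallIso (G.induce S) ⟨ρ, hρ⟩ r T o) :
    {ψ : α → V | IsBallEmbedding o par ht ρ p S r ψ}.ncard = numAut T o := by
  obtain ⟨φ, hφ⟩ := h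
  symm
  refine Set.ncard_congr (fun a _ => fun v => ((φ.symm (a v)).1 : V)) ?_ ?_ ?_
  · intro a ha
    have := isBallEmbedding_of_iso hG hT hρ (φ.trans a.symm) (by
      simp only [RelIso.trans_apply, hφ]
      rw [RelIso.symm_apply_eq]
      exact ha.symm)
    exact this
  · intro a b _ _ hab
    ext v
    exact φ.symm.injective (Subtype.ext (Subtype.ext (congrFun hab v)))
  · intro ψ hψ
    obtain ⟨φ', hφ', hval⟩ := exists_iso_of_isBallEmbedding hG hT hr hρ hψ
    refine ⟨φ'.symm.trans φ, ?_, ?_⟩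
    · change φ (φ'.symm o) = o
      rw [← hφ', φ'.symm_apply_apply, hφ, hφ']
    · funext v
      exact (congrArg (fun x => (x.1 : V)) (φ.symm_apply_apply (φ'.symm v))).trans (hval v)

theorem numAut_pos [Finite α] (T : SimpleGraph α) (o : α) : 0 < numAut T o := by
  have : Finite (T ≃g T) := Finite.of_injective (fun f => (f : α → α)) DFunLike.coe_injective
  exact (Set.ncard_pos (Set.toFinite _)).2 ⟨SimpleGraph.Iso.refl, rfl⟩

end Ball

/-! ### Counting rooted embeddings vertex by vertex -/

/-- The children of `v`, if `par` gives the parents of all vertices other than the root `o`. -/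
def childSet {α : Type*} (o : α) (par : α → α) (v : α) : Set α :=
  {c | c ≠ o ∧ par c = v}

section Count

variable {α V : Type*} {T : SimpleGraph α} {o : α} {par : α → α} {ht : α → ℕ}
  {G : SimpleGraph V} {ρ : V} {p : V → V} {d : V → ℕ}

theorem exists_isRootedMap_of_labels (hT : IsRooted T o par ht) (hG : IsRooted G ρ p d)
    (lab : V → ℕ) (l : α → ℕ)
    (hch : ∀ v, v ≠ o → ∀ x, d x = ht (par v) → ∃ y, y ≠ ρ ∧ p y = x ∧ lab y = l v) :
    ∃ ψ : α → V, IsRootedMap o par ρ p ψ ∧ ∀ v, v ≠ o → lab (ψ v) = l v := by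
  classical
  choose ch hch using fun (v : α) (x : V) =>
    (show ∃ y, v ≠ o → d x = ht (par v) → y ≠ ρ ∧ p y = x ∧ lab y = l v by
      by_cases h : v ≠ o ∧ d x = ht (par v)
      · obtain ⟨y, hy⟩ := hch v h.1 x h.2
        exact ⟨y, fun _ _ => hy⟩
      · exact ⟨ρ, fun h1 h2 => absurd ⟨h1, h2⟩ h⟩)
  have hlt : ∀ v, v ≠ o → ht (par v) < ht v := fun v hv => by
    have := hT.depth_eq v hv
    omega
  let ψ : α → V := (measure ht).wf.fix fun v rec =>
    if h : v = o then ρ else ch v (rec (par v) (hlt v h))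
  have hψo : ψ o = ρ := by
    simp only [ψ]
    rw [WellFounded.fix_eq]
    simp
  have hψ : ∀ v, v ≠ o → ψ v = ch v (ψ (par v)) := by
    intro v hv
    simp only [ψ]
    rw [WellFounded.fix_eq]
    simp [hv]
  have hd : ∀ v, d (ψ v) = ht v := by
    intro v
    induction v using hT.induction with
    | root => rw [hψo, hG.depth_root, hT.depth_root]
    | step v hv ih =>
      have h := hch v (ψ (par v)) hv ih
      rw [← hψ v hv] at h
      rw [hG.depth_eq _ h.1, h.2.1, ih, hT.depth_eq v hv]
  have hspec : ∀ v, v ≠ o → ψ v ≠ ρ ∧ p (ψ v) = ψ (par v) ∧ lab (ψ v) = l v := fun v hv => by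
    have h := hch v (ψ (par v)) hv (hd _)
    rwa [← hψ v hv] at h
  exact ⟨ψ, ⟨hψo, fun v hv => (hspec v hv).1, fun v hv => (hspec v hv).2.1⟩,
    fun v hv => (hspec v hv).2.2⟩

/-- Injectivity is a condition on siblings only: two vertices with equal images have parents with
equal images, so by induction they are siblings, and siblings are told apart by labels. -/
theorem IsRootedMap.injective_iff (hT : IsRooted T o par ht) {lab : V → ℕ}
    (hlab : ∀ y y', y ≠ ρ → y' ≠ ρ → p y = p y' → lab y = lab y' → y = y')
    {ψ : α → V} (hψ : IsRootedMap o par ρ p ψ) :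
    Function.Injective ψ ↔
      ∀ v, Function.Injective (fun c : childSet o par v => lab (ψ c)) := by
  constructor
  · rintro h v ⟨c, hc⟩ ⟨c', hc'⟩ hcc
    refine Subtype.ext (h (hlab _ _ (hψ.map_ne c hc.1) (hψ.map_ne c' hc'.1) ?_ hcc))
    rw [hψ.map_parent c hc.1, hψ.map_parent c' hc'.1, hc.2, hc'.2]
  · intro h u
    induction u using hT.induction with
    | root =>
      intro v hv
      by_contra hne
      exact hψ.map_ne v (Ne.symm hne) (hv ▸ hψ.map_root)
    | step u hu ih =>
      intro v huv
      have hv : v ≠ o := by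
        rintro rfl
        exact hψ.map_ne u hu (huv.trans hψ.map_root)
      have hpar : par u = par v := by
        apply ih
        rw [← hψ.map_parent u hu, ← hψ.map_parent v hv, huv]
      exact congrArg Subtype.val
        (@h (par v) ⟨u, hu, hpar⟩ ⟨v, hv, rfl⟩ (congrArg lab huv))

/-- An injective rooted map amounts to independent choices of injective labelings of the children of
each vertex, so the count factorizes. The hypothesis `hch` says that every allowed label is realised
by a child in the target. -/
theorem ncard_injective_rootedMaps [Fintype α] (hT : IsRooted T o par ht) (hG : IsRooted G ρ p d)
    {lab : V → ℕ} (hlab : ∀ y y', y ≠ ρ → y' ≠ ρ → p y = p y' → lab y = lab y' → y = y')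
    (Q : ∀ v : α, (childSet o par v → ℕ) → Prop)
    (hch : ∀ v g, Q v g → ∀ c, ∀ x, d x = ht v → ∃ y, y ≠ ρ ∧ p y = x ∧ lab y = g c) :
    {ψ : α → V | IsRootedMap o par ρ p ψ ∧ Function.Injective ψ ∧
        ∀ v, Q v (fun c => lab (ψ c))}.ncard =
      ∏ v, {g : childSet o par v → ℕ | Function.Injective g ∧ Q v g}.ncard := by
  classical
  simp only [← Nat.card_coe_set_eq]
  rw [← Nat.card_pi]
  let F : {ψ : α → V | IsRootedMap o par ρ p ψ ∧ Function.Injective ψ ∧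
        ∀ v, Q v (fun c => lab (ψ c))} →
      ∀ v, {g : childSet o par v → ℕ | Function.Injective g ∧ Q v g} := fun ψ v =>
    ⟨fun c => lab (ψ.1 c), (ψ.2.1.injective_iff hT hlab).1 ψ.2.2.1 v, ψ.2.2.2 v⟩
  refine Nat.card_congr (Equiv.ofBijective F ⟨?_, ?_⟩)
  · rintro ⟨ψ, h1, h2, h3⟩ ⟨ψ', h1', h2', h3'⟩ heq
    apply Subtype.ext
    funext v
    change ψ v = ψ' v
    induction v using hT.induction with
    | root => rw [h1.map_root, h1'.map_root]
    | step v hv ih =>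
      refine hlab _ _ (h1.map_ne v hv) (h1'.map_ne v hv) ?_ ?_
      · rw [h1.map_parent v hv, h1'.map_parent v hv, ih]
      · exact congrFun (congrArg Subtype.val (congrFun heq (par v))) ⟨v, hv, rfl⟩
  · intro g
    let l : α → ℕ := fun v => if h : v = o then 0 else (g (par v)).1 ⟨v, h, rfl⟩
    obtain ⟨ψ, hψ, hl⟩ := exists_isRootedMap_of_labels hT hG lab l (by
      intro v hv x hx
      have := hch _ _ (g (par v)).2.2 ⟨v, hv, rfl⟩ x hx
      simpa [l, hv] using this)
    have hval : ∀ v, (fun c : childSet o par v => lab (ψ c)) = (g v).1 := by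
      intro v
      funext ⟨c, hc, hcv⟩
      subst hcv
      change lab (ψ c) = _
      rw [hl c hc]
      simp [l, hc]
    refine ⟨⟨ψ, hψ, (hψ.injective_iff hT hlab).2 fun v => ?_, fun v => ?_⟩, ?_⟩
    · rw [hval]; exact (g v).2.1
    · rw [hval]; exact (g v).2.2
    · funext v
      exact Subtype.ext (hval v)

end Count

theorem ncard_injective_lt {β : Type*} [Finite β] (n : ℕ) :
    {g : β → ℕ | Function.Injective g ∧ ∀ c, g c < n}.ncard = n.descFactorial (Nat.card β) := by
  have := Fintype.ofFinite β
  rw [← Nat.card_coe_set_eq]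
  let e : {g : β → ℕ | Function.Injective g ∧ ∀ c, g c < n} ≃ (β ↪ Fin n) :=
    { toFun := fun g => ⟨fun c => ⟨g.1 c, g.2.2 c⟩, fun a b hab =>
        g.2.1 (congrArg Fin.val hab)⟩
      invFun := fun f => ⟨fun c => f c, fun a b hab => f.injective (Fin.ext hab),
        fun c => (f c).2⟩
      left_inv := fun g => rfl
      right_inv := fun f => rfl }
  rw [Nat.card_congr e, Nat.card_eq_fintype_card, Fintype.card_embedding_eq, Fintype.card_fin,
    Nat.card_eq_fintype_card]

/-- The at most one element of `C` is pinned to the label 0, and the others share the remaining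
labels in any order. -/
theorem ncard_injective_lt_of_zero {β : Type*} [Finite β] (C : Set β) (hC : C.Subsingleton) :
    {g : β → ℕ | Function.Injective g ∧ (∀ c, g c < Nat.card β) ∧ ∀ c ∈ C, g c = 0}.ncard =
      (Nat.card {c // c ∉ C}).factorial := by
  classical
  rcases hC.eq_empty_or_singleton with rfl | ⟨c₀, rfl⟩
  · have := ncard_injective_lt (β := β) (Nat.card β)
    rw [Nat.descFactorial_self] at this
    have e : Nat.card {c : β // c ∉ (∅ : Set β)} = Nat.card β :=
      Nat.card_congr (Equiv.subtypeUnivEquiv fun c => by simp)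
    rw [e, ← this]
    congr 1
    ext g
    simp
  · have hcard : Nat.card β = Nat.card {c : β // c ∉ ({c₀} : Set β)} + 1 := by
      have := Fintype.ofFinite β
      have h0 : 0 < Fintype.card β := Fintype.card_pos_iff.2 ⟨c₀⟩
      simp only [Nat.card_eq_fintype_card, Set.mem_singleton_iff]
      rw [Fintype.card_subtype_compl, Fintype.card_subtype_eq]
      omega
    have := ncard_injective_lt (β := {c : β // c ∉ ({c₀} : Set β)})
      (Nat.card {c : β // c ∉ ({c₀} : Set β)})
    rw [Nat.descFactorial_self] at this
    rw [← this]
    -- Away from `c₀` the labels are positive, so shifting them down by one loses nothing.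
    refine Set.ncard_congr (fun g _ c => g c - 1) ?_ ?_ ?_
    · rintro g ⟨hg, hlt, h0⟩
      have hpos : ∀ c : {c : β // c ∉ ({c₀} : Set β)}, 0 < g c := by
        rintro ⟨c, hc⟩
        rcases Nat.eq_zero_or_pos (g c) with h | h
        · exact absurd (hg (h.trans (h0 c₀ rfl).symm)) hc
        · exact h
      refine ⟨fun a b hab => Subtype.ext (hg ?_), fun c => ?_⟩
      · have := hpos a; have := hpos b; simp only at hab; omega
      · have := hpos c; have := hlt c; simp only at *; omega
    · rintro g g' ⟨hg, hlt, h0⟩ ⟨hg', hlt', h0'⟩ heq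
      funext c
      by_cases hc : c = c₀
      · rw [hc, h0 c₀ rfl, h0' c₀ rfl]
      · have h := congrFun heq ⟨c, hc⟩
        simp only at h
        have h1 : g c ≠ 0 := fun e => hc (hg (e.trans (h0 c₀ rfl).symm))
        have h1' : g' c ≠ 0 := fun e => hc (hg' (e.trans (h0' c₀ rfl).symm))
        omega
    · rintro g ⟨hg, hlt⟩
      refine ⟨fun c => if h : c = c₀ then 0 else g ⟨c, h⟩ + 1, ⟨?_, ?_, ?_⟩, ?_⟩
      · intro a b hab
        by_cases ha : a = c₀ <;> by_cases hb : b = c₀ <;> simp [ha, hb] at hab ⊢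
        exact congrArg Subtype.val (hg hab)
      · intro c
        by_cases hc : c = c₀
        · simp [hc, hcard]
        · simp only [hc, dite_false]
          have := hlt ⟨c, hc⟩
          omega
      · rintro c rfl; simp
      · funext ⟨c, hc⟩
        have hc' : c ≠ c₀ := hc
        simp [hc']

/-! ### Double counting of events, and cylinders of product measures -/

/-- If exactly `n` of the events `E i` occur on `B` and none off `B`, then `n * P(B) = ∑ P(E i)`. -/
theorem nsmul_measureReal_eq_sum {Ω ι : Type*} {mΩ : MeasurableSpace Ω} (μ : Measure Ω)
    [IsProbabilityMeasure μ] (s : Finset ι) (E : ι → Set Ω) (B : Set Ω) (n : ℕ) (hn : 0 < n)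
    (hE : ∀ i ∈ s, NullMeasurableSet (E i) μ)
    (hB : ∀ ω ∈ B, {i | i ∈ s ∧ ω ∈ E i}.ncard = n) (hsub : ∀ i ∈ s, E i ⊆ B) :
    (n : ℝ) * μ.real B = ∑ i ∈ s, μ.real (E i) := by
  classical
  -- Measurability of `B` is not assumed: since `n > 0`, `B` is the union of the `E i`.
  have hBU : B = ⋃ i ∈ s, E i := by
    apply Set.Subset.antisymm
    · intro ω hω
      have : {i | i ∈ s ∧ ω ∈ E i}.Nonempty := by
        apply Set.nonempty_of_ncard_ne_zero
        rw [hB ω hω]; omega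
      obtain ⟨i, hi, hω⟩ := this
      exact Set.mem_biUnion hi hω
    · exact Set.iUnion₂_subset hsub
  have hBm : NullMeasurableSet B μ := by
    rw [hBU]
    exact Finset.nullMeasurableSet_biUnion s hE
  have key : ∑ i ∈ s, μ (E i) = n * μ B := by
    calc ∑ i ∈ s, μ (E i) = ∑ i ∈ s, ∫⁻ ω, (E i).indicator 1 ω ∂μ :=
          Finset.sum_congr rfl fun i hi => (lintegral_indicator_one₀ (hE i hi)).symm
      _ = ∫⁻ ω, ∑ i ∈ s, (E i).indicator 1 ω ∂μ := by
          rw [lintegral_finsetSum' s fun i hi => ?_]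
          exact (aemeasurable_const (b := (1 : ENNReal))).indicator₀ (hE i hi)
      _ = ∫⁻ ω, (n : ENNReal) * B.indicator 1 ω ∂μ := by
          congr 1
          funext ω
          by_cases hω : ω ∈ B
          · rw [Set.indicator_of_mem hω, ← hB ω hω]
            simp only [Set.indicator_apply, Pi.one_apply, mul_one]
            rw [Finset.sum_boole]
            congr 1
            rw [← Set.ncard_coe_finset]
            congr 1
            ext i
            simp
          · rw [Set.indicator_of_notMem hω, mul_zero]
            exact Finset.sum_eq_zero fun i hi =>
              Set.indicator_of_notMem (fun h => hω (hsub i hi h)) _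
      _ = n * μ B := by
          rw [lintegral_const_mul' _ _ (ENNReal.natCast_ne_top n), lintegral_indicator_one₀ hBm]
  have := congrArg ENNReal.toReal key
  rw [ENNReal.toReal_sum fun i _ => measure_ne_top μ _, ENNReal.toReal_mul,
    ENNReal.toReal_natCast] at this
  exact this.symm

theorem infinitePi_cylinder_of_injective {ι J X : Type*} [Fintype ι] [MeasurableSpace X]
    (μ : J → Measure X) [∀ j, IsProbabilityMeasure (μ j)] {f : ι → J} (hf : Function.Injective f)
    {A : ι → Set X} (hA : ∀ i, MeasurableSet (A i)) :
    Measure.infinitePi μ {ω | ∀ i, ω (f i) ∈ A i} = ∏ i, μ (f i) (A i) := by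
  classical
  have h := Measure.infinitePi_pi μ (s := Finset.univ.map ⟨f, hf⟩)
    -- Coordinates off the range of `f` are unconstrained.
    (t := Function.extend f A fun _ => Set.univ) (by
      intro j hj
      obtain ⟨i, -, rfl⟩ := Finset.mem_map.1 hj
      simpa [hf.extend_apply] using hA i)
  rw [Finset.prod_map] at h
  simp only [Function.Embedding.coeFn_mk, hf.extend_apply] at h
  rw [← h]
  congr 1
  ext ω
  simp [Set.mem_pi, hf.extend_apply]

theorem measurableSet_cylinder {ι J X : Type*} [Countable ι] [MeasurableSpace X] (f : ι → J)
    {A : ι → Set X} (hA : ∀ i, MeasurableSet (A i)) :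
    MeasurableSet {ω : J → X | ∀ i, ω (f i) ∈ A i} := by
  simp only [Set.ofPred_forall]
  exact MeasurableSet.iInter fun i => measurable_pi_apply (f i) (hA i)

/-! ### Matchings of a rooted tree coded by the lower ends of their edges -/

section EndSet

variable {α : Type*} {T : SimpleGraph α} {o : α} {par : α → α} {ht : α → ℕ} {r : ℕ}

theorem depth_parent_lt (hT : IsRooted T o par ht) (hr : ∀ v, ht v ≤ r) {c : α}
    (hc : c ≠ o) : ht (par c) < r := by
  have := hT.depth_eq c hc
  have := hr c
  omega

/-- `C` is the set of the lower ends of the edges of a matching which saturates all vertices of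
height less than `r`. -/
structure IsEndSet (o : α) (par : α → α) (ht : α → ℕ) (r : ℕ) (C : Set α) : Prop where
  root : o ∉ C
  of_mem : ∀ v, ht v < r → v ∈ C → ∀ c ∈ childSet o par v, c ∉ C
  of_notMem : ∀ v, ht v < r → v ∉ C → ∃ c ∈ childSet o par v, c ∈ C ∧
    ∀ c' ∈ childSet o par v, c' ∈ C → c' = c

/-- The subgraph whose edges join the vertices of `C` to their parents. -/
def endSubgraph (hT : IsRooted T o par ht) (C : Set α) (hC : o ∉ C) : T.Subgraph where
  verts := {v | v ∈ C ∨ ∃ c ∈ C, par c = v}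
  Adj u v := (v ∈ C ∧ u = par v) ∨ (u ∈ C ∧ v = par u)
  adj_sub := by
    rintro u v (⟨h, rfl⟩ | ⟨h, rfl⟩)
    · exact (hT.adj_parent fun e => hC (e ▸ h)).symm
    · exact hT.adj_parent fun e => hC (e ▸ h)
  edge_vert := by
    rintro u v (⟨h, rfl⟩ | ⟨h, rfl⟩)
    · exact Or.inr ⟨v, h, rfl⟩
    · exact Or.inl h
  symm := by
    constructor
    intro u v h
    exact h.symm

/-- Every edge joins a vertex to its parent, so a matching is determined by its lower ends. A
saturated vertex is matched either upwards (it is in `C` and no child is) or downwards (exactly one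
child is in `C`). -/
theorem ncard_matchings_eq_ncard_endSets (hT : IsRooted T o par ht) (hr : ∀ v, ht v ≤ r) :
    {M : T.Subgraph | M.IsMatching ∧ {v | ht v < r} ⊆ M.verts}.ncard =
      {C : Set α | IsEndSet o par ht r C}.ncard := by
  refine Set.ncard_congr (fun M _ => {v | v ≠ o ∧ M.Adj v (par v)}) ?_ ?_ ?_
  · rintro M ⟨hM, hsat⟩
    refine ⟨fun h => h.1 rfl, ?_, ?_⟩
    · rintro v hv ⟨hvo, hadj⟩ c ⟨hco, rfl⟩ ⟨-, hc⟩
      have := hM.eq_of_adj_left hadj hc.symm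
      have e1 := hT.depth_eq _ hvo
      have e2 := hT.depth_eq c hco
      rw [this] at e1
      omega
    · intro v hv hvC
      obtain ⟨w, hw, -⟩ := hM (hsat hv)
      rcases (hT.adj_iff _ _).1 hw.adj_sub with ⟨hwo, rfl⟩ | ⟨hvo, rfl⟩
      · refine ⟨w, ⟨hwo, rfl⟩, ⟨hwo, hw.symm⟩, ?_⟩
        rintro c ⟨hco, hc⟩ ⟨-, hc'⟩
        rw [hc] at hc'
        exact hM.eq_of_adj_left hc'.symm hw
      · exact absurd ⟨hvo, hw⟩ hvC
  · rintro M M' ⟨hM, -⟩ ⟨hM', -⟩ h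
    have key : ∀ (M : T.Subgraph) u v, M.Adj u v ↔
        (v ∈ {v | v ≠ o ∧ M.Adj v (par v)} ∧ u = par v) ∨
        (u ∈ {v | v ≠ o ∧ M.Adj v (par v)} ∧ v = par u) := by
      intro M u v
      constructor
      · intro huv
        rcases (hT.adj_iff _ _).1 huv.adj_sub with ⟨hv, rfl⟩ | ⟨hu, rfl⟩
        · exact Or.inl ⟨⟨hv, huv.symm⟩, rfl⟩
        · exact Or.inr ⟨⟨hu, huv⟩, rfl⟩
      · rintro (⟨⟨-, h⟩, rfl⟩ | ⟨⟨-, h⟩, rfl⟩)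
        · exact h.symm
        · exact h
    have hadj : M.Adj = M'.Adj := by
      funext u v
      rw [eq_iff_iff, key M, key M']
      rw [h]
    -- A matching has no isolated vertices, so its vertex set is determined by its edges.
    refine SimpleGraph.Subgraph.ext ?_ hadj
    rw [← hM.support_eq_verts, ← hM'.support_eq_verts]
    ext v
    simp [SimpleGraph.Subgraph.mem_support, hadj]
  · intro C hC
    have hCo : ∀ v ∈ C, v ≠ o := fun v hv e => hC.root (e ▸ hv)
    refine ⟨endSubgraph hT C hC.root, ⟨?_, ?_⟩, ?_⟩
    · intro v hv
      by_cases hvC : v ∈ C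
      · refine ⟨par v, Or.inr ⟨hvC, rfl⟩, ?_⟩
        rintro w (⟨hw, rfl⟩ | ⟨-, rfl⟩)
        · exact absurd hw (hC.of_mem _ (depth_parent_lt hT hr (hCo w hw)) hvC w
            ⟨hCo w hw, rfl⟩)
        · rfl
      · obtain ⟨c, hc, rfl⟩ := hv.resolve_left hvC
        refine ⟨c, Or.inl ⟨hc, rfl⟩, ?_⟩
        rintro w (⟨hw, hwc⟩ | ⟨h, -⟩)
        · obtain ⟨c₀, -, -, huniq⟩ := hC.of_notMem _ (depth_parent_lt hT hr (hCo c hc)) hvC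
          rw [huniq c ⟨hCo c hc, rfl⟩ hc, huniq w ⟨hCo w hw, hwc.symm⟩ hw]
        · exact absurd h hvC
    · intro v hv
      by_cases hvC : v ∈ C
      · exact Or.inl hvC
      · obtain ⟨c, hc, hcC, -⟩ := hC.of_notMem v hv hvC
        exact Or.inr ⟨c, hcC, hc.2⟩
    · ext v
      simp only [endSubgraph, Set.mem_ofPred_eq, and_true]
      constructor
      · rintro ⟨hvo, ⟨hp, hv⟩ | hv⟩
        · exfalso
          have e1 := hT.depth_eq _ hvo
          have e2 := hT.depth_eq _ (hCo _ hp)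
          rw [← hv] at e2
          omega
        · exact hv
      · exact fun hv => ⟨hCo v hv, Or.inr hv⟩

/-- The number of children of `v` outside `C`. -/
noncomputable def numChildrenOutside (o : α) (par : α → α) (C : Set α) (v : α) : ℕ :=
  Nat.card {c : childSet o par v // (c : α) ∉ C}

theorem IsEndSet.subsingleton {C : Set α} (hC : IsEndSet o par ht r C)
    (hT : IsRooted T o par ht) (hr : ∀ v, ht v ≤ r) (v : α) :
    {c : childSet o par v | (c : α) ∈ C}.Subsingleton := by
  rintro ⟨c, hc⟩ hcC ⟨c', hc'⟩ hcC'
  have hv : ht v < r := hc.2 ▸ depth_parent_lt hT hr hc.1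
  by_cases hvC : v ∈ C
  · exact absurd hcC (hC.of_mem v hv hvC c hc)
  · obtain ⟨c₀, -, -, huniq⟩ := hC.of_notMem v hv hvC
    exact Subtype.ext ((huniq c hc hcC).trans (huniq c' hc' hcC').symm)

theorem IsEndSet.numChildrenOutside_of_mem {C : Set α} (hC : IsEndSet o par ht r C) {v : α}
    (hv : ht v < r) (hvC : v ∈ C) :
    numChildrenOutside o par C v = Nat.card (childSet o par v) :=
  Nat.card_congr (Equiv.subtypeUnivEquiv fun c => hC.of_mem v hv hvC c c.2)

theorem IsEndSet.numChildrenOutside_of_notMem [Finite α] {C : Set α}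
    (hC : IsEndSet o par ht r C) {v : α} (hv : ht v < r) (hvC : v ∉ C) :
    numChildrenOutside o par C v + 1 = Nat.card (childSet o par v) := by
  classical
  have := Fintype.ofFinite α
  obtain ⟨c, hc, hcC, huniq⟩ := hC.of_notMem v hv hvC
  have e : numChildrenOutside o par C v =
      Nat.card {x : childSet o par v // x ≠ ⟨c, hc⟩} := by
    refine Nat.card_congr (Equiv.subtypeEquivRight fun x => ?_)
    refine not_congr ⟨fun hx => Subtype.ext (huniq x x.2 hx), ?_⟩
    rintro rfl
    exact hcC
  rw [e]
  have h0 : 0 < Fintype.card (childSet o par v) := Fintype.card_pos_iff.2 ⟨⟨c, hc⟩⟩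
  simp only [Nat.card_eq_fintype_card]
  rw [Fintype.card_subtype_compl, Fintype.card_subtype_eq]
  omega

end EndSet

section Valid

variable {α : Type*} [Fintype α] {k : ℕ} {T : SimpleGraph α} {o : α} {par : α → α}

theorem dist_le_height (T : SimpleGraph α) (o v : α) : T.dist o v ≤ height T o :=
  Finset.le_sup (f := T.dist o) (Finset.mem_univ v)

theorem IsValid.card_childSet (h : IsValid k T o) (hT : IsRooted T o par (T.dist o)) (v : α)
    (hv : Odd (T.dist o v)) : Nat.card (childSet o par v) = k := by
  have hvo : v ≠ o := by rintro rfl; simp at hv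
  have hn : T.neighborSet v = insert (par v) (childSet o par v) := by
    ext w
    rw [SimpleGraph.mem_neighborSet, hT.adj_iff, Set.mem_insert_iff]
    constructor
    · rintro (⟨h1, h2⟩ | ⟨-, h2⟩)
      · exact Or.inr ⟨h1, h2.symm⟩
      · exact Or.inl h2
    · rintro (h | h)
      · exact Or.inr ⟨hvo, h⟩
      · exact Or.inl ⟨h.1, h.2.symm⟩
  have hnot : par v ∉ childSet o par v := by
    rintro ⟨h1, h2⟩
    have e1 := hT.depth_eq v hvo
    have e2 := hT.depth_eq _ h1
    rw [h2] at e2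
    omega
  have := h.degree_odd v hv
  rw [hn, Set.ncard_insert_of_notMem hnot] at this
  rw [Nat.card_coe_set_eq]
  omega

theorem IsValid.innerEven_union_odd (h : IsValid k T o) :
    innerEvenVerts T o ∪ oddVerts T o = {v | T.dist o v < height T o} := by
  ext v
  simp only [innerEvenVerts, oddVerts, Set.mem_union, Set.mem_ofPred_eq]
  have h1 := dist_le_height T o v
  have h2 := h.even_height
  constructor
  · rintro (hv | hv)
    · exact hv.2
    · refine lt_of_le_of_ne h1 fun e => ?_
      rw [e] at hv
      exact (Nat.not_odd_iff_even.2 h2) hv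
  · intro hv
    rcases Nat.even_or_odd (T.dist o v) with he | ho
    · exact Or.inl ⟨he, hv⟩
    · exact Or.inr ho

theorem IsValid.numMatchings_eq (h : IsValid k T o) (hT : IsRooted T o par (T.dist o)) :
    numMatchings T o (innerEvenVerts T o) =
      {C : Set α | IsEndSet o par (T.dist o) (height T o) C}.ncard := by
  rw [← ncard_matchings_eq_ncard_endSets hT (dist_le_height T o), numMatchings,
    h.innerEven_union_odd]

end Valid

/-! ### The branching process: types as matching data -/

theorem isRooted_wordTree : IsRooted wordTree [] List.tail List.length where
  depth_root := rfl
  depth_eq := by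
    rintro (_ | ⟨i, w⟩) h
    · exact absurd rfl h
    · simp
  adj_iff := by
    intro u v
    simp only [wordTree, SimpleGraph.fromRel_adj]
    constructor
    · rintro ⟨-, ⟨i, rfl⟩ | ⟨i, rfl⟩⟩ <;> simp
    · rintro (⟨h, rfl⟩ | ⟨h, rfl⟩)
      · obtain ⟨i, w, rfl⟩ := List.exists_cons_of_ne_nil h
        simp
      · obtain ⟨i, w, rfl⟩ := List.exists_cons_of_ne_nil h
        simp

/-- The type with the given parity of the height (`true` for odd); `c` says whether the particle is
matched to its parent. -/
def typeOf (odd c : Bool) : ParticleType :=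
  match odd, c with
  | false, false => .aEven
  | false, true => .bEven
  | true, true => .aOdd
  | true, false => .bOdd

theorem typeOf_injective {e e' c c' : Bool} (h : typeOf e c = typeOf e' c') : e = e' ∧ c = c' := by
  cases e <;> cases e' <;> cases c <;> cases c' <;> simp_all [typeOf]

/-- The number of children of a particle of type `typeOf odd c`. -/
def numOffspring (k : ℕ) (odd c : Bool) (n : ℕ) : ℕ :=
  if odd then k else if c then n else n + 1

/-- In each offspring list the child matched to its parent, if there is one, stands at index 0. The
assumption `1 ≤ k` makes the list of a b-odd particle have length `k` despite the truncated `k - 1`.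
-/
theorem offspring_getElem? {k : ℕ} (hk : 1 ≤ k) (odd c : Bool) (n i : ℕ) :
    (offspring k (typeOf odd c) n)[i]? =
      if i < numOffspring k odd c n then some (typeOf (!odd) (!c && decide (i = 0))) else none := by
  cases odd <;> cases c <;> rcases i with _ | i <;>
    simp [typeOf, offspring, numOffspring, List.getElem?_replicate] <;>
    (try split_ifs) <;> first | rfl | omega

theorem particleType_cons_typeOf {k : ℕ} (hk : 1 ≤ k) {ω : List ℕ → ℕ} {w : List ℕ}
    {odd c : Bool} (hw : particleType k ω w = some (typeOf odd c)) (i : ℕ) :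
    particleType k ω (i :: w) =
      if i < numOffspring k odd c (ω w) then some (typeOf (!odd) (!c && decide (i = 0)))
      else none := by
  rw [particleType, hw, Option.bind_some, offspring_getElem? hk]

/-- The label of a word is its last letter. -/
def wordLabel (w : List ℕ) : ℕ := w.headD 0

theorem word_ext {y y' : List ℕ} (hy : y ≠ []) (hy' : y' ≠ []) (h : y.tail = y'.tail)
    (hl : wordLabel y = wordLabel y') : y = y' := by
  obtain ⟨i, w, rfl⟩ := List.exists_cons_of_ne_nil hy
  obtain ⟨i', w', rfl⟩ := List.exists_cons_of_ne_nil hy'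
  simp_all [wordLabel]

theorem wordLabel_cons_tail {y : List ℕ} (hy : y ≠ []) : wordLabel y :: y.tail = y := by
  obtain ⟨i, w, rfl⟩ := List.exists_cons_of_ne_nil hy
  rfl

theorem exists_eq_of_injective_lt {β : Type*} [Finite β] {g : β → ℕ} (hg : Function.Injective g)
    (hlt : ∀ c, g c < Nat.card β) {i : ℕ} (hi : i < Nat.card β) : ∃ c, g c = i := by
  have := Fintype.ofFinite β
  rw [Nat.card_eq_fintype_card] at hi
  simp only [Nat.card_eq_fintype_card] at hlt
  have hinj : Function.Injective (fun c => (⟨g c, hlt c⟩ : Fin (Fintype.card β))) :=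
    fun a b hab => hg (congrArg Fin.val hab)
  have hbij := (Fintype.bijective_iff_injective_and_card _).2 ⟨hinj, by simp⟩
  obtain ⟨c, hc⟩ := hbij.2 ⟨i, hi⟩
  exact ⟨c, congrArg Fin.val hc⟩

theorem card_eq_of_injective_mem_iff {β : Type*} {g : β → ℕ} (hg : Function.Injective g)
    {n : ℕ} (hn : ∀ i, i < n ↔ ∃ c, g c = i) : Nat.card β = n := by
  have e : β ≃ Fin n := Equiv.ofBijective (fun c => ⟨g c, (hn _).2 ⟨c, rfl⟩⟩)
    ⟨fun a b hab => hg (congrArg Fin.val hab), fun i => by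
      obtain ⟨c, hc⟩ := (hn i).1 i.2
      exact ⟨c, Fin.ext hc⟩⟩
  simpa using Nat.card_congr e

section Branching

variable {α : Type*} {T : SimpleGraph α} {o : α} {par : α → α} {ht : α → ℕ} {k r : ℕ}

/-- The labels of the children of `v` are an initial segment, and the child in `C` comes first. -/
def IsPlaneLabeling (o : α) (par : α → α) (C : Set α) (v : α) (g : childSet o par v → ℕ) : Prop :=
  (∀ c, g c < Nat.card (childSet o par v)) ∧ ∀ c ∈ {c : childSet o par v | (c : α) ∈ C}, g c = 0

/-- The plane embeddings of the tree which are compatible with `C`. -/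
def planeMaps (o : α) (par : α → α) (C : Set α) : Set (α → List ℕ) :=
  {ψ | IsRootedMap o par [] List.tail ψ ∧ Function.Injective ψ ∧
    ∀ v, IsPlaneLabeling o par C v fun c => wordLabel (ψ c)}

/-- The event that the even inner vertices have the numbers of children prescribed by `C`. -/
def offspringEvent (o : α) (par : α → α) (ht : α → ℕ) (r : ℕ) (C : Set α) (ψ : α → List ℕ) :
    Set (List ℕ → ℕ) :=
  {ω | ∀ v : {v : α // Even (ht v) ∧ ht v < r},
    ω (ψ v) ∈ ({numChildrenOutside o par C v} : Set ℕ)}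

theorem numOffspring_eq_of_mem_offspringEvent [Finite α] {C : Set α}
    (hodd : ∀ v, Odd (ht v) → Nat.card (childSet o par v) = k) (hC : IsEndSet o par ht r C)
    {ψ : α → List ℕ} {ω : List ℕ → ℕ} (hω : ω ∈ offspringEvent o par ht r C ψ) {v : α}
    (hv : ht v < r) [Decidable (Odd (ht v))] [Decidable (v ∈ C)] :
    numOffspring k (decide (Odd (ht v))) (decide (v ∈ C)) (ω (ψ v)) =
      Nat.card (childSet o par v) := by
  by_cases ho : Odd (ht v)
  · simp [numOffspring, ho, hodd v ho]
  · have h := hω ⟨v, Nat.not_odd_iff_even.1 ho, hv⟩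
    simp only [Set.mem_singleton_iff] at h
    by_cases hvC : v ∈ C
    · simp [numOffspring, ho, hvC, h, hC.numChildrenOutside_of_mem hv hvC]
    · simp [numOffspring, ho, hvC, h, hC.numChildrenOutside_of_notMem hv hvC]

-- On this event the types along `ψ` are forced, by induction from the root: parity comes from the
-- height, and the status "matched to the parent" is membership in `C`. In particular `ω` and `ψ`
-- determine `C`.
open scoped Classical in
theorem particleType_of_mem_offspringEvent [Finite α] (hk : 1 ≤ k) (hT : IsRooted T o par ht)
    (hr : ∀ v, ht v ≤ r) (hodd : ∀ v, Odd (ht v) → Nat.card (childSet o par v) = k) {C : Set α}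
    (hC : IsEndSet o par ht r C) {ψ : α → List ℕ} (hψ : ψ ∈ planeMaps o par C)
    {ω : List ℕ → ℕ} (hω : ω ∈ offspringEvent o par ht r C ψ) (v : α) :
    particleType k ω (ψ v) = some (typeOf (decide (Odd (ht v))) (decide (v ∈ C))) := by
  obtain ⟨hmap, hinj, hlab⟩ := hψ
  induction v using hT.induction with
  | root =>
    rw [hmap.map_root]
    simp [particleType, hT.depth_root, hC.root, typeOf]
  | step v hv ih =>
    have hu : ht (par v) < r := depth_parent_lt hT hr hv
    have hlt := (hlab (par v)).1 ⟨v, hv, rfl⟩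
    have hcons := particleType_cons_typeOf hk ih (wordLabel (ψ v))
    rw [← hmap.map_parent v hv, wordLabel_cons_tail (hmap.map_ne v hv), hmap.map_parent v hv,
      numOffspring_eq_of_mem_offspringEvent hodd hC hω hu, if_pos hlt] at hcons
    rw [hcons]
    -- A parent not matched upwards is matched to one child, which the plane labeling puts first;
    -- injectivity of `ψ` excludes any other child with label 0.
    have hiff : v ∈ C ↔ par v ∉ C ∧ wordLabel (ψ v) = 0 := by
      constructor
      · intro hvC
        exact ⟨fun hpC => hC.of_mem _ hu hpC v ⟨hv, rfl⟩ hvC, (hlab _).2 ⟨v, hv, rfl⟩ hvC⟩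
      · rintro ⟨hpC, h0⟩
        obtain ⟨c, hc, hcC, -⟩ := hC.of_notMem _ hu hpC
        have hc0 := (hlab _).2 ⟨c, hc⟩ hcC
        have hcv : ψ v = ψ c := word_ext (hmap.map_ne v hv) (hmap.map_ne c hc.1)
          (by rw [hmap.map_parent v hv, hmap.map_parent c hc.1, hc.2]) (h0.trans hc0.symm)
        exact hinj hcv ▸ hcC
    have hpar : Odd (ht v) ↔ ¬ Odd (ht (par v)) := by
      rw [hT.depth_eq v hv, Nat.odd_add_one]
    simp only [hiff, hpar, decide_not, Bool.decide_and]

theorem isBallEmbedding_of_mem_offspringEvent [Finite α] (hk : 1 ≤ k) (hT : IsRooted T o par ht)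
    (hr : ∀ v, ht v ≤ r) (hodd : ∀ v, Odd (ht v) → Nat.card (childSet o par v) = k) {C : Set α}
    (hC : IsEndSet o par ht r C) {ψ : α → List ℕ} (hψ : ψ ∈ planeMaps o par C)
    {ω : List ℕ → ℕ} (hω : ω ∈ offspringEvent o par ht r C ψ) :
    IsBallEmbedding o par ht [] List.tail (particles k ω) r ψ := by
  classical
  have htype := particleType_of_mem_offspringEvent hk hT hr hodd hC hψ hω
  refine ⟨hψ.1, hψ.2.1, fun v => ?_, ?_⟩
  · simp [particles, htype v]
  · intro v hv y hy hy0 hyv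
    have hcons := particleType_cons_typeOf hk (htype v) (wordLabel y)
    rw [← hyv, wordLabel_cons_tail hy0, hyv,
      numOffspring_eq_of_mem_offspringEvent hodd hC hω hv] at hcons
    have hsome : (particleType k ω y).isSome := hy
    rw [hcons] at hsome
    have hlt : wordLabel y < Nat.card (childSet o par v) := by
      by_contra h
      rw [if_neg h] at hsome
      simp at hsome
    obtain ⟨c, hc⟩ := exists_eq_of_injective_lt
      ((hψ.1.injective_iff hT fun _ _ => word_ext).1 hψ.2.1 v) (hψ.2.2 v).1 hlt
    refine ⟨c, word_ext (hψ.1.map_ne c c.2.1) hy0 ?_ hc⟩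
    rw [hψ.1.map_parent c c.2.1, c.2.2, hyv]

/-- Conversely, `C` is read off from the types, as the set of vertices whose particle is a-odd or
b-even. Since the ball is full, the labels of the children of an inner vertex are exactly an initial
segment of length its offspring number. -/
theorem exists_endSet_of_isBallEmbedding [Finite α] (hk : 1 ≤ k) (hT : IsRooted T o par ht)
    (hr : ∀ v, ht v ≤ r) {ψ : α → List ℕ} {ω : List ℕ → ℕ}
    (hψ : IsBallEmbedding o par ht [] List.tail (particles k ω) r ψ) :
    ∃ C, IsEndSet o par ht r C ∧ ψ ∈ planeMaps o par C ∧ ω ∈ offspringEvent o par ht r C ψ := by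
  classical
  have hmap := hψ.isRootedMap
  have hinj := (hmap.injective_iff hT fun _ _ => word_ext).1 hψ.injective
  obtain ⟨C, hCdef⟩ : ∃ C : Set α, ∀ v, v ∈ C ↔
      ∃ e, particleType k ω (ψ v) = some (typeOf e true) := ⟨{v | _}, fun _ => Iff.rfl⟩
  have hmemC : ∀ {v e c}, particleType k ω (ψ v) = some (typeOf e c) → (v ∈ C ↔ c = true) := by
    intro v e c h
    rw [hCdef]
    constructor
    · rintro ⟨e', h'⟩
      exact (typeOf_injective (Option.some.inj (h.symm.trans h'))).2
    · rintro rfl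
      exact ⟨e, h⟩
  have hstep : ∀ v, v ≠ o → ∀ e c, particleType k ω (ψ (par v)) = some (typeOf e c) →
      particleType k ω (ψ v) = some (typeOf (!e) (!c && decide (wordLabel (ψ v) = 0))) ∧
        wordLabel (ψ v) < numOffspring k e c (ω (ψ (par v))) := by
    intro v hv e c h
    have hcons := particleType_cons_typeOf hk h (wordLabel (ψ v))
    rw [← hmap.map_parent v hv, wordLabel_cons_tail (hmap.map_ne v hv), hmap.map_parent v hv]
      at hcons
    have hsome : (particleType k ω (ψ v)).isSome := hψ.mem v
    rw [hcons] at hsome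
    have hlt : wordLabel (ψ v) < numOffspring k e c (ω (ψ (par v))) := by
      by_contra h
      rw [if_neg h] at hsome
      simp at hsome
    rw [if_pos hlt] at hcons
    exact ⟨hcons, hlt⟩
  have htype : ∀ v, particleType k ω (ψ v) =
      some (typeOf (decide (Odd (ht v))) (decide (v ∈ C))) := by
    intro v
    induction v using hT.induction with
    | root =>
      have h : particleType k ω (ψ o) = some (typeOf false false) := by rw [hmap.map_root]; rfl
      rw [h, hT.depth_root]
      simp [hmemC h]
    | step v hv ih =>
      have h := (hstep v hv _ _ ih).1
      have hpar : Odd (ht v) ↔ ¬ Odd (ht (par v)) := by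
        rw [hT.depth_eq v hv, Nat.odd_add_one]
      rw [h]
      have := hmemC h
      simp only [Bool.and_eq_true] at this
      simp only [hpar, this, decide_not, Bool.decide_and, Bool.decide_eq_true]
  have hlab : ∀ v, ht v < r → ∀ i, i < numOffspring k (decide (Odd (ht v))) (decide (v ∈ C))
      (ω (ψ v)) ↔ ∃ c : childSet o par v, wordLabel (ψ c) = i := by
    intro v hv i
    constructor
    · intro hi
      have hcons := particleType_cons_typeOf hk (htype v) i
      rw [if_pos hi] at hcons
      have hmem : i :: ψ v ∈ particles k ω := by simp [particles, hcons]
      obtain ⟨c, hc⟩ := hψ.full v hv _ hmem (by simp) rfl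
      have hco : c ≠ o := by
        rintro rfl
        rw [hmap.map_root] at hc
        simp at hc
      have hcp : par c = v := hψ.injective (by rw [← hmap.map_parent c hco, hc]; rfl)
      exact ⟨⟨c, hco, hcp⟩, by simp [hc, wordLabel]⟩
    · rintro ⟨⟨c, hco, rfl⟩, rfl⟩
      exact (hstep c hco _ _ (htype _)).2
  have hcard : ∀ v, ht v < r → Nat.card (childSet o par v) =
      numOffspring k (decide (Odd (ht v))) (decide (v ∈ C)) (ω (ψ v)) := fun v hv =>
    card_eq_of_injective_mem_iff (hinj v) (hlab v hv)
  have hiff : ∀ v, v ≠ o → (v ∈ C ↔ par v ∉ C ∧ wordLabel (ψ v) = 0) := by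
    intro v hv
    rw [hmemC (hstep v hv _ _ (htype _)).1]
    simp
  have hC : IsEndSet o par ht r C := by
    refine ⟨?_, ?_, ?_⟩
    · have h : particleType k ω (ψ o) = some (typeOf false false) := by rw [hmap.map_root]; rfl
      simp [hmemC h]
    · rintro v hv hvC c ⟨hco, rfl⟩ hcC
      exact ((hiff c hco).1 hcC).1 hvC
    · intro v hv hvC
      -- A vertex not matched upwards has a first child: an a-even particle has `n + 1` children,
      -- and a b-odd one has `k ≥ 1`.
      obtain ⟨c, hc⟩ := (hlab v hv 0).1 (by
        rw [decide_eq_false hvC]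
        cases decide (Odd (ht v))
        · exact Nat.succ_pos _
        · exact hk)
      refine ⟨c, c.2, ?_, ?_⟩
      · rw [hiff c c.2.1, c.2.2]
        exact ⟨hvC, hc⟩
      · intro c' hc' hcC'
        have := ((hiff c' hc'.1).1 hcC').2
        exact congrArg Subtype.val (@hinj v ⟨c', hc'⟩ c (this.trans hc.symm))
  refine ⟨C, hC, ⟨hmap, hψ.injective, fun v => ⟨?_, ?_⟩⟩, ?_⟩
  · intro c
    have hv : ht v < r := c.2.2 ▸ depth_parent_lt hT hr c.2.1
    rw [hcard v hv]
    exact (hlab v hv _).2 ⟨c, rfl⟩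
  · intro c hc
    exact ((hiff c c.2.1).1 hc).2
  · rintro ⟨v, he, hv⟩
    have h := hcard v hv
    have ho : ¬ Odd (ht v) := Nat.not_odd_iff_even.2 he
    by_cases hvC : v ∈ C
    · rw [← hC.numChildrenOutside_of_mem hv hvC] at h
      simp [numOffspring, ho, hvC] at h
      exact h.symm
    · rw [← hC.numChildrenOutside_of_notMem hv hvC] at h
      simp [numOffspring, ho, hvC] at h
      exact h.symm

end Branching

/-! ### The ball probability of the branching process -/

section BranchingFormula

variable {α : Type*} {T : SimpleGraph α} {o : α} {par : α → α} {ht : α → ℕ} {k r : ℕ}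

theorem ncard_planeMaps [Fintype α] (hT : IsRooted T o par ht) (hr : ∀ v, ht v ≤ r) {C : Set α}
    (hC : IsEndSet o par ht r C) :
    (planeMaps o par C).ncard = ∏ v, (numChildrenOutside o par C v).factorial := by
  rw [planeMaps, ncard_injective_rootedMaps hT isRooted_wordTree (fun _ _ => word_ext)
    (fun v g => IsPlaneLabeling o par C v g)
    fun v g _ c x _ => ⟨g c :: x, by simp, rfl, rfl⟩]
  exact Finset.prod_congr rfl fun v _ => ncard_injective_lt_of_zero _ (hC.subsingleton hT hr v)

theorem finite_planeMaps [Fintype α] (hT : IsRooted T o par ht) (hr : ∀ v, ht v ≤ r) {C : Set α}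
    (hC : IsEndSet o par ht r C) : (planeMaps o par C).Finite := by
  -- `Set.ncard` vanishes on infinite sets, so a nonzero count proves finiteness.
  apply Set.finite_of_ncard_ne_zero
  rw [ncard_planeMaps hT hr hC]
  exact Finset.prod_ne_zero_iff.2 fun v _ => Nat.factorial_ne_zero _

instance instIsProbabilityMeasurePoissonLaw (k : ℕ) : IsProbabilityMeasure (poissonLaw k) := by
  unfold poissonLaw
  infer_instance

theorem measureReal_offspringEvent [Finite α]
    [Fintype {v : α // Even (ht v) ∧ ht v < r}] (k : ℕ) (C : Set α) {ψ : α → List ℕ}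
    (hψ : Function.Injective ψ) :
    (poissonLaw k).real (offspringEvent o par ht r C ψ) =
      ∏ v : {v : α // Even (ht v) ∧ ht v < r},
        Real.exp (-(k : ℝ)) * (k : ℝ) ^ numChildrenOutside o par C v /
          ((numChildrenOutside o par C v).factorial : ℝ) := by
  rw [measureReal_def, poissonLaw, offspringEvent,
    infinitePi_cylinder_of_injective (f := fun v : {v : α // Even (ht v) ∧ ht v < r} => ψ v) _
      (hψ.comp Subtype.val_injective) (fun _ => measurableSet_singleton _), ENNReal.toReal_prod]
  refine Finset.prod_congr rfl fun v _ => ?_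
  rw [← measureReal_def, poissonMeasure_real_singleton]
  simp

theorem ballIso_branchingTree_iff (hT : IsRooted T o par ht) (hr : ∀ v, ht v ≤ r)
    (ω : List ℕ → ℕ) : BallIso (branchingTree k ω) (branchingRoot k ω) r T o ↔
      ∃ ψ, IsBallEmbedding o par ht [] List.tail (particles k ω) r ψ :=
  ballIso_iff_exists_isBallEmbedding isRooted_wordTree hT hr (nil_mem_particles k ω)

theorem ncard_isBallEmbedding_branchingTree (hT : IsRooted T o par ht) (hr : ∀ v, ht v ≤ r)
    (ω : List ℕ → ℕ) (h : BallIso (branchingTree k ω) (branchingRoot k ω) r T o) :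
    {ψ : α → List ℕ | IsBallEmbedding o par ht [] List.tail (particles k ω) r ψ}.ncard =
      numAut T o :=
  ncard_isBallEmbedding isRooted_wordTree hT hr (nil_mem_particles k ω) h

-- Double counting over pairs `(C, ψ)`. For fixed `ω` these pairs correspond to the embeddings onto
-- the ball, because `C` can be recovered from the types of the particles in the image of `ψ`.
open scoped Classical in
theorem numAut_mul_branchingBallProb [Fintype α] (hk : 1 ≤ k) (hT : IsRooted T o par ht)
    (hr : ∀ v, ht v ≤ r) (hodd : ∀ v, Odd (ht v) → Nat.card (childSet o par v) = k) :
    (numAut T o : ℝ) * branchingBallProb k r T o =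
      ∑ C : {C : Set α // IsEndSet o par ht r C},
        (∏ v, ((numChildrenOutside o par C v).factorial : ℝ)) *
        ∏ v : {v : α // Even (ht v) ∧ ht v < r},
          (Real.exp (-(k : ℝ)) * (k : ℝ) ^ numChildrenOutside o par C v /
          ((numChildrenOutside o par C v).factorial : ℝ)) := by
  let s : Finset (Σ _ : {C : Set α // IsEndSet o par ht r C}, α → List ℕ) :=
    Finset.univ.sigma fun C => (finite_planeMaps hT hr C.2).toFinset
  have hs : ∀ i, i ∈ s ↔ i.2 ∈ planeMaps o par i.1 := fun i => by simp [s]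
  have hcount := nsmul_measureReal_eq_sum (poissonLaw k) s
    (fun i => offspringEvent o par ht r i.1 i.2)
    {ω | BallIso (branchingTree k ω) (branchingRoot k ω) r T o} (numAut T o) (numAut_pos T o)
    (fun i _ => (measurableSet_cylinder _ fun _ => measurableSet_singleton _).nullMeasurableSet)
    (by
      intro ω hω
      rw [← ncard_isBallEmbedding_branchingTree hT hr ω hω]
      refine Set.ncard_congr (fun i _ => i.2) ?_ ?_ ?_
      · rintro ⟨C, ψ⟩ ⟨hi, hE⟩
        exact isBallEmbedding_of_mem_offspringEvent hk hT hr hodd C.2 ((hs _).1 hi) hE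
      · rintro ⟨C, ψ⟩ ⟨C', ψ'⟩ ⟨hi, hE⟩ ⟨hi', hE'⟩ (rfl : ψ = ψ')
        have h := particleType_of_mem_offspringEvent hk hT hr hodd C.2 ((hs _).1 hi) hE
        have h' := particleType_of_mem_offspringEvent hk hT hr hodd C'.2 ((hs _).1 hi') hE'
        have : C = C' := by
          apply Subtype.ext
          ext v
          have := (typeOf_injective (Option.some.inj ((h v).symm.trans (h' v)))).2
          simpa using this
        rw [this]
      · intro ψ hψ
        obtain ⟨C, hC, hp, hE⟩ := exists_endSet_of_isBallEmbedding hk hT hr hψ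
        exact ⟨⟨⟨C, hC⟩, ψ⟩, ⟨(hs _).2 hp, hE⟩, rfl⟩)
    (by
      rintro ⟨C, ψ⟩ hi ω hω
      exact (ballIso_branchingTree_iff hT hr ω).2
        ⟨ψ, isBallEmbedding_of_mem_offspringEvent hk hT hr hodd C.2 ((hs _).1 hi) hω⟩)
  rw [branchingBallProb, hcount, Finset.sum_sigma]
  refine Finset.sum_congr rfl fun C _ => ?_
  have hinj : ∀ ψ ∈ (finite_planeMaps hT hr C.2).toFinset, Function.Injective ψ := fun ψ hψ =>
    (show ψ ∈ planeMaps o par (C : Set α) from (finite_planeMaps hT hr C.2).mem_toFinset.1 hψ).2.1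
  have hsum := Finset.sum_congr (rfl : (finite_planeMaps hT hr C.2).toFinset = _) fun ψ hψ =>
    measureReal_offspringEvent (o := o) (par := par) (ht := ht) (r := r) k (C : Set α) (hinj ψ hψ)
  rw [hsum, Finset.sum_const, nsmul_eq_mul,
    ← Set.ncard_eq_toFinset_card _ (finite_planeMaps hT hr C.2), ncard_planeMaps hT hr C.2]
  rw [Nat.cast_prod]

/-- The right-hand side does not depend on `C`. Factorials at even vertices cancel; an odd vertex in
`C` has `m = k`, while one outside `C` has `m = k - 1` and receives a factor `k` from the Poisson
weight of its parent. -/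
theorem prod_factorial_mul_prod_poisson [Fintype α] (hT : IsRooted T o par ht)
    (hr : ∀ v, ht v ≤ r) (heven : Even r)
    (hodd : ∀ v, Odd (ht v) → Nat.card (childSet o par v) = k) {C : Set α}
    (hC : IsEndSet o par ht r C) [Fintype {v : α // Even (ht v) ∧ ht v < r}] :
    (∏ v, ((numChildrenOutside o par C v).factorial : ℝ)) *
        ∏ v : {v : α // Even (ht v) ∧ ht v < r},
          (Real.exp (-(k : ℝ)) * (k : ℝ) ^ numChildrenOutside o par C v /
          ((numChildrenOutside o par C v).factorial : ℝ)) =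
      Real.exp (-((k : ℝ) * ({v | Even (ht v) ∧ ht v < r}.ncard : ℝ))) *
        (k.factorial : ℝ) ^ {v | Odd (ht v)}.ncard := by
  classical
  set m := numChildrenOutside o par C with hm
  have hlt : ∀ v, Odd (ht v) → ht v < r := fun v hv =>
    lt_of_le_of_ne (hr v) fun e => Nat.not_odd_iff_even.2 heven (e ▸ hv)
  let I : Finset α := Finset.univ.filter fun v => Even (ht v) ∧ ht v < r
  let U : Finset α := Finset.univ.filter fun v => Odd (ht v)
  have hI : {v | Even (ht v) ∧ ht v < r}.ncard = I.card := by
    rw [← Set.ncard_coe_finset]; congr 1; ext v; simp [I]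
  have hU : {v | Odd (ht v)}.ncard = U.card := by
    rw [← Set.ncard_coe_finset]; congr 1; ext v; simp [U]
  have hsub : ∀ f : α → ℝ, ∏ v : {v : α // Even (ht v) ∧ ht v < r}, f v = ∏ v ∈ I, f v :=
    fun f => (Finset.prod_subtype I (fun v => by simp [I]) f).symm
  have hleaf : ∀ v, ¬ ht v < r → m v = 0 := by
    intro v hv
    rw [hm, numChildrenOutside]
    have : IsEmpty {c : childSet o par v // (c : α) ∉ C} :=
      ⟨fun c => hv (c.1.2.2 ▸ depth_parent_lt hT hr c.1.2.1)⟩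
    simp
  have hfact : ∏ v, ((m v).factorial : ℝ) =
      (∏ v ∈ I, ((m v).factorial : ℝ)) * ∏ v ∈ U, ((m v).factorial : ℝ) := by
    rw [← Finset.prod_union]
    · refine (Finset.prod_subset (Finset.subset_univ _) fun v _ hv => ?_).symm
      have : m v = 0 := hleaf v fun hvr => hv (by
        rcases Nat.even_or_odd (ht v) with h | h
        · simp [I, h, hvr]
        · simp [U, h])
      simp [this]
    · refine Finset.disjoint_filter.2 fun v _ h h' => ?_
      exact Nat.not_odd_iff_even.2 h.1 h'
  have hpow : ∏ v ∈ I, (k : ℝ) ^ m v = ∏ u ∈ U, if u ∈ C then (1 : ℝ) else k := by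
    rw [Finset.prod_pow_eq_pow_sum, Finset.prod_ite, Finset.prod_const_one, one_mul,
      Finset.prod_const]
    congr 1
    -- Odd vertices outside `C`, grouped by parent, are what the exponents `m v` of the inner even
    -- vertices count.
    rw [Finset.card_eq_sum_card_fiberwise (f := par) (t := I)]
    · refine Finset.sum_congr rfl fun v hv => ?_
      have hv : Even (ht v) ∧ ht v < r := by simpa [I] using hv
      rw [hm, numChildrenOutside, Nat.card_congr (Equiv.subtypeSubtypeEquivSubtypeInter
        (fun c => c ∈ childSet o par v) (fun c => c ∉ C)), Nat.card_eq_fintype_card,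
        Fintype.card_subtype]
      congr 1
      ext c
      rw [Finset.mem_filter_univ, Finset.mem_filter, Finset.mem_filter, Finset.mem_filter_univ]
      constructor
      · rintro ⟨⟨hco, hcv⟩, hcC⟩
        refine ⟨⟨?_, hcC⟩, hcv⟩
        rw [hT.depth_eq c hco, hcv]
        exact hv.1.add_one
      · rintro ⟨⟨ho, hcC⟩, hcv⟩
        exact ⟨⟨hT.ne_root_of_depth (fun e => by simp [e] at ho), hcv⟩, hcC⟩
    · intro u hu
      have hu : Odd (ht u) ∧ u ∉ C := by simpa [U] using hu
      have hne : u ≠ o := hT.ne_root_of_depth fun e => by simp [e] at hu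
      have e := hT.depth_eq u hne
      have : Even (ht (par u)) := by
        have h := hu.1
        rw [e, Nat.odd_add_one, Nat.not_odd_iff_even] at h
        exact h
      simp [I, this, depth_parent_lt hT hr hne]
  have hUk : ∀ u ∈ U, (if u ∈ C then (1 : ℝ) else k) * ((m u).factorial : ℝ) = k.factorial := by
    intro u hu
    have hu : Odd (ht u) := by simpa [U] using hu
    by_cases huC : u ∈ C
    · rw [if_pos huC, hm, hC.numChildrenOutside_of_mem (hlt u hu) huC, hodd u hu, one_mul]
    · have h := hC.numChildrenOutside_of_notMem (hlt u hu) huC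
      rw [hodd u hu] at h
      rw [if_neg huC, ← h, Nat.factorial_succ]
      push_cast
      rfl
  rw [hsub (fun v => Real.exp (-(k : ℝ)) * (k : ℝ) ^ m v / ((m v).factorial : ℝ)), hfact, hI, hU]
  calc _ = (∏ v ∈ I, ((m v).factorial : ℝ) *
        (Real.exp (-(k : ℝ)) * (k : ℝ) ^ m v / ((m v).factorial : ℝ))) *
        ∏ v ∈ U, ((m v).factorial : ℝ) := by rw [Finset.prod_mul_distrib]; ring
    _ = (∏ v ∈ I, Real.exp (-(k : ℝ)) * (k : ℝ) ^ m v) * ∏ v ∈ U, ((m v).factorial : ℝ) := by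
        congr 1
        refine Finset.prod_congr rfl fun v _ => ?_
        have : ((m v).factorial : ℝ) ≠ 0 := by exact_mod_cast Nat.factorial_ne_zero _
        field_simp
    _ = Real.exp (-(k : ℝ)) ^ I.card *
        ∏ u ∈ U, ((if u ∈ C then (1 : ℝ) else k) * ((m u).factorial : ℝ)) := by
        rw [Finset.prod_mul_distrib, hpow, Finset.prod_const, Finset.prod_mul_distrib]
        ring
    _ = _ := by
        rw [Finset.prod_congr rfl hUk, Finset.prod_const, ← Real.exp_nat_mul]
        congr 2
        ring

end BranchingFormula

theorem branchingBallProb_eq_ballFormula {α : Type*} [Fintype α] {k : ℕ} (hk : 1 ≤ k)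
    {T : SimpleGraph α} {o : α} (hT : IsValid k T o) :
    branchingBallProb k (height T o) T o = ballFormula k T o := by
  classical
  obtain ⟨par, hpar⟩ := exists_isRooted hT.isTree o
  have hodd := hT.card_childSet hpar
  have h := numAut_mul_branchingBallProb hk hpar (dist_le_height T o) hodd
  rw [Finset.sum_congr rfl fun C _ => prod_factorial_mul_prod_poisson hpar (dist_le_height T o)
    hT.even_height hodd C.2, Finset.sum_const, nsmul_eq_mul, Finset.card_univ,
    ← Nat.card_eq_fintype_card] at h
  have h0 : (numAut T o : ℝ) ≠ 0 := by exact_mod_cast (numAut_pos T o).ne'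
  rw [ballFormula, eq_div_iff h0, mul_comm, h, hT.numMatchings_eq hpar, ← Nat.card_coe_set_eq]
  exact mul_comm _ _

/-! ### The tree `𝐓_{k,d}` as a rooted forest with labelled children -/

section BigTree

variable {k d : ℕ}

/-- The parent of a vertex of `𝐓_{k,d}`. -/
def bigParent : EvenVertex k d ⊕ OddVertex k d → EvenVertex k d ⊕ OddVertex k d
  | .inl [] => .inl []
  | .inl (x :: w) => .inr ⟨w, x.1⟩
  | .inr u => .inl u.parent

/-- The height of a vertex of `𝐓_{k,d}`. -/
def bigDepth : EvenVertex k d ⊕ OddVertex k d → ℕ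
  | .inl w => 2 * w.length
  | .inr u => 2 * u.parent.length + 1

/-- The index of a vertex of `𝐓_{k,d}` among the children of its parent. -/
def bigLabel : EvenVertex k d ⊕ OddVertex k d → ℕ
  | .inl [] => 0
  | .inl (x :: _) => x.2
  | .inr u => u.index

theorem isRooted_bigTree : IsRooted (bigTree k d) (.inl []) bigParent bigDepth where
  depth_root := rfl
  depth_eq := by
    rintro ((_ | ⟨x, w⟩) | u) h
    · exact absurd rfl h
    · simp [bigDepth, bigParent]
      ring
    · simp [bigDepth, bigParent]
  adj_iff := by
    rintro ((_ | ⟨x, w⟩) | ⟨w, i⟩) ((_ | ⟨x', w'⟩) | ⟨w', i'⟩) <;>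
      simp [bigTree, IsChild, bigParent]
    · constructor
      · rintro (h | ⟨⟨j, rfl⟩, rfl⟩)
        · exact Or.inl h.symm
        · exact Or.inr ⟨rfl, rfl⟩
      · rintro (h | ⟨rfl, rfl⟩)
        · exact Or.inl h.symm
        · exact Or.inr ⟨⟨x.2, rfl⟩, rfl⟩
    · constructor
      · rintro (⟨⟨j, rfl⟩, rfl⟩ | h)
        · exact Or.inl ⟨rfl, rfl⟩
        · exact Or.inr h.symm
      · rintro (⟨rfl, rfl⟩ | h)
        · exact Or.inl ⟨⟨x'.2, rfl⟩, rfl⟩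
        · exact Or.inr h.symm

theorem bigTree_ext (y y' : EvenVertex k d ⊕ OddVertex k d) (hy : y ≠ .inl [])
    (hy' : y' ≠ .inl []) (hp : bigParent y = bigParent y') (hl : bigLabel y = bigLabel y') :
    y = y' := by
  rcases y with (_ | ⟨x, w⟩) | ⟨w, i⟩
  · exact absurd rfl hy
  · rcases y' with (_ | ⟨x', w'⟩) | ⟨w', i'⟩
    · exact absurd rfl hy'
    · simp only [bigParent, Sum.inr.injEq, OddVertex.mk.injEq] at hp
      have : x = x' := Prod.ext hp.2 (Fin.ext hl)
      rw [this, hp.1]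
    · simp [bigParent] at hp
  · rcases y' with (_ | ⟨x', w'⟩) | ⟨w', i'⟩
    · exact absurd rfl hy'
    · simp [bigParent] at hp
    · simp only [bigParent, Sum.inl.injEq] at hp
      have : i = i' := Fin.ext hl
      rw [this, hp]

theorem exists_child_bigTree {x : EvenVertex k d ⊕ OddVertex k d} {n : ℕ}
    (hn : n < if Even (bigDepth x) then d else k) :
    ∃ y, y ≠ .inl [] ∧ bigParent y = x ∧ bigLabel y = n := by
  rcases x with w | u
  · have he : Even (bigDepth (.inl w : EvenVertex k d ⊕ OddVertex k d)) := by simp [bigDepth]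
    rw [if_pos he] at hn
    exact ⟨.inr ⟨w, ⟨n, hn⟩⟩, by simp, rfl, rfl⟩
  · have he : ¬ Even (bigDepth (.inr u : EvenVertex k d ⊕ OddVertex k d)) := by
      simp [bigDepth]
    rw [if_neg he] at hn
    exact ⟨.inl ((u.index, ⟨n, hn⟩) :: u.parent), by simp, rfl, rfl⟩

theorem bigLabel_lt {y : EvenVertex k d ⊕ OddVertex k d} (hy : y ≠ .inl []) :
    bigLabel y < if Even (bigDepth (bigParent y)) then d else k := by
  rcases y with (_ | ⟨x, w⟩) | u
  · exact absurd rfl hy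
  · simp [bigLabel, bigParent, bigDepth]
  · simp [bigLabel, bigParent, bigDepth]

end BigTree

/-! ### Embeddings into `𝐓_{k,d}` and the draws that make them balls -/

section OneOut

variable {α : Type*} {T : SimpleGraph α} {o : α} {par : α → α} {ht : α → ℕ} {k d r : ℕ}

/-- The embeddings of the tree into `𝐓_{k,d}` as rooted trees. -/
def bigMaps (k d : ℕ) (o : α) (par : α → α) : Set (α → EvenVertex k d ⊕ OddVertex k d) :=
  {ψ | IsRootedMap o par (.inl []) bigParent ψ ∧ Function.Injective ψ}

theorem ncard_bigMaps [Fintype α] (hT : IsRooted T o par ht) :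
    (bigMaps k d o par).ncard =
      ∏ v, (if Even (ht v) then d else k).descFactorial (Nat.card (childSet o par v)) := by
  rw [Finset.prod_congr rfl fun v _ => (ncard_injective_lt _).symm]
  rw [← ncard_injective_rootedMaps hT (isRooted_bigTree (k := k) (d := d)) bigTree_ext
    (fun v g => ∀ c, g c < if Even (ht v) then d else k)
    fun v g hg c x hx => exists_child_bigTree (by rw [hx]; exact hg c)]
  congr 1
  ext ψ
  -- The bound on the labels is automatic, since labels are indices among the children in `𝐓_{k,d}`.
  refine ⟨fun h => ⟨h.1, h.2, fun v c => ?_⟩, fun h => ⟨h.1, h.2.1⟩⟩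
  have := bigLabel_lt (h.1.map_ne c c.2.1)
  rwa [h.1.map_parent c c.2.1, c.2.2, h.1.depth hT isRooted_bigTree] at this

/-- The vertices of even height. -/
abbrev EvenPart (ht : α → ℕ) : Type _ := {v : α // Even (ht v)}

/-- The vertices of odd height. -/
abbrev OddPart (ht : α → ℕ) : Type _ := {v : α // Odd (ht v)}

theorem exists_even_odd_parts (hT : IsRooted T o par ht) {ψ : α → EvenVertex k d ⊕ OddVertex k d}
    (hψ : IsRootedMap o par (.inl []) bigParent ψ) :
    ∃ (e : EvenPart ht → EvenVertex k d) (f : OddPart ht → OddVertex k d),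
      (∀ v : EvenPart ht, ψ v = .inl (e v)) ∧ ∀ u : OddPart ht, ψ u = .inr (f u) := by
  have he : ∀ v : EvenPart ht, ∃ w, ψ v = .inl w := by
    rintro ⟨v, hv⟩
    rw [← hψ.depth hT isRooted_bigTree v] at hv
    rcases h : ψ v with w | u
    · exact ⟨w, rfl⟩
    · rw [h] at hv
      simp [bigDepth] at hv
  have hf : ∀ v : OddPart ht, ∃ u, ψ v = .inr u := by
    rintro ⟨v, hv⟩
    rw [← hψ.depth hT isRooted_bigTree v] at hv
    rcases h : ψ v with w | u
    · rw [h, ← Nat.not_even_iff_odd] at hv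
      simp [bigDepth] at hv
    · exact ⟨u, rfl⟩
  choose e he using he
  choose f hf using hf
  exact ⟨e, f, he, hf⟩

theorem even_parent (hT : IsRooted T o par ht) {u : α} (hu : Odd (ht u)) : Even (ht (par u)) := by
  have hne : u ≠ o := hT.ne_root_of_depth fun e => by simp [e] at hu
  have := hT.depth_eq u hne
  rw [this, Nat.odd_add_one, Nat.not_odd_iff_even] at hu
  exact hu

theorem odd_parent (hT : IsRooted T o par ht) {v : α} (hv : Even (ht v)) (hne : v ≠ o) :
    Odd (ht (par v)) := by
  have := hT.depth_eq v hne
  rw [this, Nat.even_add_one, Nat.not_even_iff_odd] at hv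
  exact hv

/-- A rooted embedding `ψ` into `𝐓_{k,d}`, with its restrictions `e` and `f` to the vertices of
even and odd height. -/
structure IsBigEmbedding (o : α) (par : α → α) (ht : α → ℕ)
    (ψ : α → EvenVertex k d ⊕ OddVertex k d) (e : EvenPart ht → EvenVertex k d)
    (f : OddPart ht → OddVertex k d) : Prop where
  isRootedMap : IsRootedMap o par (.inl []) bigParent ψ
  injective : Function.Injective ψ
  even : ∀ v : EvenPart ht, ψ v = .inl (e v)
  odd : ∀ u : OddPart ht, ψ u = .inr (f u)

namespace IsBigEmbedding

variable {ψ : α → EvenVertex k d ⊕ OddVertex k d} {e : EvenPart ht → EvenVertex k d}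
  {f : OddPart ht → OddVertex k d}

theorem injective_even (h : IsBigEmbedding o par ht ψ e f) : Function.Injective e :=
  fun u v huv => Subtype.ext (h.injective (by rw [h.even, h.even, huv]))

theorem injective_odd (h : IsBigEmbedding o par ht ψ e f) : Function.Injective f :=
  fun u v huv => Subtype.ext (h.injective (by rw [h.odd, h.odd, huv]))

theorem parent_odd (h : IsBigEmbedding o par ht ψ e f) (hT : IsRooted T o par ht)
    (u : OddPart ht) : (f u).parent = e ⟨par u, even_parent hT u.2⟩ := by
  have hne : (u : α) ≠ o := hT.ne_root_of_depth fun e => by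
    have := u.2
    simp [e] at this
  have := h.isRootedMap.map_parent u hne
  rw [h.odd, h.even ⟨par u, even_parent hT u.2⟩] at this
  exact Sum.inl_injective this

theorem exists_odd_of_even_cons (h : IsBigEmbedding o par ht ψ e f) (hT : IsRooted T o par ht)
    {v : EvenPart ht} {x : Fin d × Fin k} {w : EvenVertex k d} (hv : e v = x :: w) :
    ∃ u, (f u) = ⟨w, x.1⟩ ∧ T.Adj v u := by
  have hne : (v : α) ≠ o := by
    intro hvo
    have h1 := h.even v
    rw [hvo, h.isRootedMap.map_root, hv] at h1
    simp at h1
  have := h.isRootedMap.map_parent v hne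
  rw [h.even, hv, h.odd ⟨par v, odd_parent hT v.2 hne⟩] at this
  exact ⟨⟨par v, odd_parent hT v.2 hne⟩, (Sum.inr_injective this).symm, hT.adj_parent hne⟩

/-- An odd vertex has `k` children both in the tree and in `𝐓_{k,d}`, so the image contains all
children of its odd vertices. -/
theorem exists_even_child (h : IsBigEmbedding o par ht ψ e f) [Finite α] (hT : IsRooted T o par ht)
    (hodd : ∀ v, Odd (ht v) → Nat.card (childSet o par v) = k) (u : OddPart ht) (j : Fin k) :
    ∃ v, e v = ((f u).index, j) :: (f u).parent := by
  have hlt : ∀ c : childSet o par (u : α), bigLabel (ψ c) < Nat.card (childSet o par (u : α)) := by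
    intro c
    have := bigLabel_lt (h.isRootedMap.map_ne c c.2.1)
    rw [h.isRootedMap.map_parent c c.2.1, c.2.2, h.isRootedMap.depth hT isRooted_bigTree,
      if_neg (Nat.not_even_iff_odd.2 u.2)] at this
    rwa [hodd u u.2]
  obtain ⟨c, hc⟩ := exists_eq_of_injective_lt
    ((h.isRootedMap.injective_iff hT bigTree_ext).1 h.injective u) hlt
    (i := j) (by rw [hodd u u.2]; exact j.2)
  have heq : ψ c = .inl (((f u).index, j) :: (f u).parent) := by
    refine bigTree_ext _ _ (h.isRootedMap.map_ne c c.2.1) (by simp) ?_ hc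
    rw [h.isRootedMap.map_parent c c.2.1, c.2.2, h.odd]
    rfl
  have hev : Even (ht c) := by
    rw [hT.depth_eq c c.2.1, c.2.2]
    exact u.2.add_one
  exact ⟨⟨c, hev⟩, Sum.inl_injective ((h.even ⟨c, hev⟩).symm.trans heq)⟩

/-- All even vertices belong to `𝐓[𝒪]`, and fullness at odd vertices holds by `exists_even_child`.
Only two conditions remain: odd vertices of the image are drawn, and no other child of an inner even
vertex is. -/
theorem isBallEmbedding_iff (h : IsBigEmbedding o par ht ψ e f) [Finite α]
    (hT : IsRooted T o par ht)
    (hodd : ∀ v, Odd (ht v) → Nat.card (childSet o par v) = k)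
    (ω : EvenVertex k d → OddVertex k d) :
    IsBallEmbedding o par ht (.inl []) bigParent (oneOutVerts ω) r ψ ↔
      (∀ u, f u ∈ Set.range ω) ∧
      ∀ v : EvenPart ht, ht v < r → ∀ i, (⟨e v, i⟩ : OddVertex k d) ∈ Set.range ω →
        (⟨e v, i⟩ : OddVertex k d) ∈ Set.range f := by
  constructor
  · intro hb
    refine ⟨fun u => ?_, fun v hv i hi => ?_⟩
    · have := hb.mem u
      rw [h.odd] at this
      simpa [oneOutVerts] using this
    · obtain ⟨u, hu⟩ := hb.full v hv (.inr ⟨e v, i⟩) (Or.inr ⟨_, hi, rfl⟩) (by simp)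
        (by rw [h.even]; rfl)
      rcases Nat.even_or_odd (ht u) with hev | hod
      · rw [h.even ⟨u, hev⟩] at hu
        simp at hu
      · exact ⟨⟨u, hod⟩, Sum.inr_injective ((h.odd ⟨u, hod⟩).symm.trans hu)⟩
  · rintro ⟨h1, h2⟩
    refine ⟨h.isRootedMap, h.injective, fun v => ?_, fun v hv y hy hy0 hyp => ?_⟩
    · rcases Nat.even_or_odd (ht v) with hev | hod
      · rw [h.even ⟨v, hev⟩]
        exact Or.inl ⟨_, rfl⟩
      · rw [h.odd ⟨v, hod⟩]
        exact Or.inr ⟨_, h1 _, rfl⟩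
    · rcases Nat.even_or_odd (ht v) with hev | hod
      · rw [h.even ⟨v, hev⟩] at hyp
        rcases y with (_ | ⟨x, w⟩) | ⟨w, i⟩
        · exact absurd rfl hy0
        · simp [bigParent] at hyp
        · obtain rfl : w = e ⟨v, hev⟩ := Sum.inl_injective hyp
          have hmem : (⟨e ⟨v, hev⟩, i⟩ : OddVertex k d) ∈ Set.range ω := by
            simpa [oneOutVerts] using hy
          obtain ⟨u, hu⟩ := h2 ⟨v, hev⟩ hv i hmem
          exact ⟨u, by rw [h.odd, hu]⟩
      · rw [h.odd ⟨v, hod⟩] at hyp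
        rcases y with (_ | ⟨x, w⟩) | ⟨w, i⟩
        · exact absurd rfl hy0
        · have hyp : (⟨w, x.1⟩ : OddVertex k d) = f ⟨v, hod⟩ := Sum.inr_injective hyp
          obtain ⟨c, hc⟩ := h.exists_even_child hT hodd ⟨v, hod⟩ x.2
          rw [← hyp] at hc
          exact ⟨c, by rw [h.even, hc]⟩
        · simp [bigParent] at hyp

/-- The vertices of even height which are grandchildren of vertices `e v` of smaller height than
`r`, through a vertex that is not in the image of the tree. -/
abbrev OuterVertex (ht : α → ℕ) (r : ℕ) (e : EvenPart ht → EvenVertex k d)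
    (f : OddPart ht → OddVertex k d) : Type _ :=
  {x : ({v : EvenPart ht // ht v < r} × Fin d) × Fin k //
    (⟨e x.1.1, x.1.2⟩ : OddVertex k d) ∉ Set.range f}

/-- A drawn odd vertex is drawn by its parent or by one of its children. For an odd vertex of the
image these all lie in the image; for one hanging off an inner even vertex, they are that vertex and
outer vertices. -/
theorem isBallEmbedding_iff_of_mem_evenNbrs (h : IsBigEmbedding o par ht ψ e f) [Finite α]
    (hT : IsRooted T o par ht)
    (hodd : ∀ v, Odd (ht v) → Nat.card (childSet o par v) = k)
    {ω : EvenVertex k d → OddVertex k d} (hω : ∀ w, ω w ∈ evenNbrs w) :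
    IsBallEmbedding o par ht (.inl []) bigParent (oneOutVerts ω) r ψ ↔
      (∀ x : OuterVertex ht r e f,
        ω ((x.1.1.2, x.1.2) :: e x.1.1.1) ≠ ⟨e x.1.1.1, x.1.1.2⟩) ∧
      (∀ v : EvenPart ht, ht v < r → ω (e v) ∈ Set.range f) ∧
      ∀ u, ∃ v, ω (e v) = f u := by
  rw [h.isBallEmbedding_iff hT hodd]
  constructor
  · rintro ⟨h1, h2⟩
    refine ⟨fun x hx => x.2 (h2 _ x.1.1.1.2 _ ⟨_, hx⟩), fun v hv => ?_, fun u => ?_⟩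
    · rcases (mem_evenNbrs _ _).1 (hω (e v)) with hp | ⟨j, hj⟩
      · have heq : ω (e v) = ⟨e v, (ω (e v)).index⟩ := OddVertex.ext hp rfl
        rw [heq]
        exact h2 v hv _ ⟨e v, heq⟩
      · obtain ⟨u, hu, -⟩ := h.exists_odd_of_even_cons hT hj
        exact ⟨u, hu⟩
    · obtain ⟨w, hw⟩ := h1 u
      have := hω w
      rw [hw] at this
      rcases (mem_evenNbrs _ _).1 this with hp | ⟨j, hj⟩
      · rw [h.parent_odd hT] at hp
        exact ⟨_, by rw [hp, hw]⟩
      · obtain ⟨v, hv⟩ := h.exists_even_child hT hodd u j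
        exact ⟨v, by rw [hv, ← hj, hw]⟩
  · rintro ⟨h1, h2, h3⟩
    refine ⟨fun u => ?_, ?_⟩
    · obtain ⟨v, hv⟩ := h3 u
      exact ⟨_, hv⟩
    · rintro v hv i ⟨w, hw⟩
      have := hω w
      rw [hw] at this
      rcases (mem_evenNbrs _ _).1 this with hp | ⟨j, hj⟩
      · have hp : e v = w := hp
        have := h2 v hv
        rwa [hp, hw] at this
      · by_contra hnot
        refine h1 ⟨((⟨v, hv⟩, i), j), hnot⟩ ?_
        rw [hj] at hw
        exact hw

end IsBigEmbedding

end OneOut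

/-! ### The law of a single draw -/

section Law

variable {k d : ℕ}

instance instIsProbabilityMeasureDrawLaw [NeZero d] : IsProbabilityMeasure (drawLaw k d) := by
  unfold drawLaw
  infer_instance

theorem ae_mem_evenNbrs [NeZero d] : ∀ᵐ ω ∂(drawLaw k d), ∀ w, ω w ∈ evenNbrs w := by
  rw [ae_all_iff]
  intro w
  have hmp := measurePreserving_eval_infinitePi
    (fun v : EvenVertex k d => uniformOn (evenNbrs v)) w
  refine hmp.quasiMeasurePreserving.ae (p := fun y => y ∈ evenNbrs w) ?_
  exact (mem_ae_iff_prob_eq_one MeasurableSet.of_discrete).2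
    (uniformOn_self (evenNbrs_finite w) (evenNbrs_nonempty w))

theorem ncard_evenNbrs (w : EvenVertex k d) :
    (evenNbrs w).ncard = if w = [] then d else d + 1 := by
  have hrange : (Set.range fun i : Fin d => (⟨w, i⟩ : OddVertex k d)).ncard = d := by
    rw [← Set.image_univ, Set.ncard_image_of_injective, Set.ncard_univ, Nat.card_fin]
    intro i j hij
    exact congrArg OddVertex.index hij
  rcases w with _ | ⟨x, w⟩
  · rw [if_pos rfl]
    convert hrange using 2
    ext u
    rw [mem_evenNbrs]
    constructor
    · rintro (h | ⟨j, h⟩)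
      · exact ⟨u.index, OddVertex.ext h.symm rfl⟩
      · simp at h
    · rintro ⟨i, rfl⟩
      exact Or.inl rfl
  · rw [if_neg (by simp)]
    have : evenNbrs (x :: w) = insert (⟨w, x.1⟩ : OddVertex k d)
        (Set.range fun i : Fin d => (⟨x :: w, i⟩ : OddVertex k d)) := by
      ext u
      rw [mem_evenNbrs, Set.mem_insert_iff]
      constructor
      · rintro (h | ⟨j, h⟩)
        · exact Or.inr ⟨u.index, OddVertex.ext h.symm rfl⟩
        · obtain ⟨rfl, rfl⟩ := List.cons.inj h
          exact Or.inl rfl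
      · rintro (rfl | ⟨i, rfl⟩)
        · exact Or.inr ⟨x.2, rfl⟩
        · exact Or.inl rfl
    rw [this, Set.ncard_insert_of_notMem, hrange]
    rintro ⟨i, hi⟩
    have := congrArg (fun u => u.parent.length) hi
    simp at this

open scoped Classical in
theorem uniformOn_evenNbrs_real_singleton [NeZero d] (w : EvenVertex k d) (y : OddVertex k d) :
    (uniformOn (evenNbrs w)).real {y} =
      if y ∈ evenNbrs w then ((if w = [] then (d : ℝ) else d + 1))⁻¹ else 0 := by
  have hfin := evenNbrs_finite w
  have hc := Set.ncard_eq_toFinset_card _ hfin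
  rw [ncard_evenNbrs] at hc
  have h := uniformOn_apply_finset (s := hfin.toFinset) (t := {y})
  rw [Set.Finite.coe_toFinset, Finset.coe_singleton, ← hc] at h
  rw [measureReal_def, h]
  by_cases hy : y ∈ evenNbrs w
  · have : hfin.toFinset ∩ {y} = {y} :=
      Finset.inter_eq_right.2 (by simpa using hy)
    rw [this, if_pos hy, ENNReal.toReal_div, ENNReal.toReal_natCast, ENNReal.toReal_natCast]
    split_ifs <;> simp
  · have : hfin.toFinset ∩ {y} = ∅ := by
      rw [Finset.inter_singleton_of_notMem]
      simpa using hy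
    rw [this, if_neg hy]
    simp

end Law

/-! ### Patterns of draws and their probabilities -/

section Patterns

variable {α : Type*} {T : SimpleGraph α} {o : α} {par : α → α} {ht : α → ℕ} {k d r : ℕ}

open scoped Classical in
/-- The probability that the image of `v` draws the image of `u`. -/
noncomputable def drawProb (T : SimpleGraph α) (o : α) (d : ℕ) (v u : α) : ℝ :=
  if T.Adj v u then (if v = o then (d : ℝ) else d + 1)⁻¹ else 0

open scoped Classical in
/-- The probability that the image of `v` draws the image of the given vertex, respectively that it
draws none of the images of the vertices of the tree. -/
noncomputable def optDrawProb [Fintype α] (T : SimpleGraph α) (o : α) (ht : α → ℕ) (d : ℕ) (v : α) :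
    Option (OddPart ht) → ℝ
  | some u => drawProb T o d v u
  | none => 1 - ∑ u : OddPart ht, drawProb T o d v u

/-- Every vertex of odd height is drawn, and every vertex of even height less than `r` draws a
vertex of the tree. -/
def IsCovering (ht : α → ℕ) (r : ℕ) (g : EvenPart ht → Option (OddPart ht)) : Prop :=
  (∀ u, ∃ v, g v = some u) ∧ ∀ v : EvenPart ht, ht v < r → g v ≠ none

namespace IsBigEmbedding

variable {ψ : α → EvenVertex k d ⊕ OddVertex k d} {e : EvenPart ht → EvenVertex k d}
  {f : OddPart ht → OddVertex k d}

theorem mem_evenNbrs_iff (h : IsBigEmbedding o par ht ψ e f) (hT : IsRooted T o par ht)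
    (v : EvenPart ht) (u : OddPart ht) : f u ∈ evenNbrs (e v) ↔ T.Adj v u := by
  rw [← adj_iff_of_isRootedMap isRooted_bigTree hT h.isRootedMap h.injective, h.even, h.odd]
  rfl

theorem even_eq_nil_iff (h : IsBigEmbedding o par ht ψ e f) (v : EvenPart ht) :
    e v = [] ↔ (v : α) = o := by
  constructor
  · intro hv
    by_contra hne
    exact h.isRootedMap.map_ne v hne (by rw [h.even, hv])
  · intro hv
    have := h.even v
    rw [hv, h.isRootedMap.map_root] at this
    exact (Sum.inl_injective this).symm

theorem measureReal_draw [NeZero d] (h : IsBigEmbedding o par ht ψ e f) (hT : IsRooted T o par ht)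
    (v : EvenPart ht) (u : OddPart ht) :
    (uniformOn (evenNbrs (e v))).real {f u} = drawProb T o d v u := by
  classical
  rw [uniformOn_evenNbrs_real_singleton, drawProb]
  simp only [h.mem_evenNbrs_iff hT, h.even_eq_nil_iff]

/-- The set of draws prescribed by an optional vertex of the tree. -/
def drawSet (f : OddPart ht → OddVertex k d) : Option (OddPart ht) → Set (OddVertex k d)
  | some u => {f u}
  | none => (Set.range f)ᶜ

theorem measureReal_drawSet [Fintype α] [NeZero d] (h : IsBigEmbedding o par ht ψ e f)
    (hT : IsRooted T o par ht) (v : EvenPart ht) (x : Option (OddPart ht)) :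
    (uniformOn (evenNbrs (e v))).real (drawSet f x) = optDrawProb T o ht d v x := by
  classical
  rcases x with _ | u
  · have hr : Set.range f = ⋃ u ∈ (Finset.univ : Finset (OddPart ht)), {f u} := by
      ext y; simp [eq_comm]
    rw [drawSet, optDrawProb, probReal_compl_eq_one_sub MeasurableSet.of_discrete, hr,
      measureReal_biUnion_finset]
    · congr 1
      exact Finset.sum_congr rfl fun u _ => h.measureReal_draw hT v u
    · intro u _ u' _ huu
      simpa using fun e => huu (h.injective_odd e)
    · exact fun _ _ => MeasurableSet.of_discrete
  · exact h.measureReal_draw hT v u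

/-- The vertices of even height whose draws determine whether `ψ` is an embedding onto a ball. -/
def drawPos (e : EvenPart ht → EvenVertex k d) (f : OddPart ht → OddVertex k d) :
    EvenPart ht ⊕ OuterVertex ht r e f → EvenVertex k d
  | .inl v => e v
  | .inr x => (x.1.1.2, x.1.2) :: e x.1.1.1

/-- The draws prescribed at these vertices by a pattern of draws. -/
def drawBox (e : EvenPart ht → EvenVertex k d) (f : OddPart ht → OddVertex k d)
    (g : EvenPart ht → Option (OddPart ht)) :
    EvenPart ht ⊕ OuterVertex ht r e f → Set (OddVertex k d)
  | .inl v => drawSet f (g v)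
  | .inr x => {(⟨e x.1.1.1, x.1.1.2⟩ : OddVertex k d)}ᶜ

/-- Distinctness of the positions is what makes the prescribed draws independent. An outer vertex is
never in the image, because its parent is not. -/
theorem drawPos_injective (h : IsBigEmbedding o par ht ψ e f) (hT : IsRooted T o par ht) :
    Function.Injective (drawPos (r := r) e f) := by
  have hcross : ∀ (v : EvenPart ht) (x : OuterVertex ht r e f),
      e v ≠ (x.1.1.2, x.1.2) :: e x.1.1.1 := by
    intro v x hx
    obtain ⟨u, hu, -⟩ := h.exists_odd_of_even_cons hT hx
    exact x.2 ⟨u, hu⟩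
  rintro (v | x) (v' | x') hxx
  · exact congrArg _ (h.injective_even hxx)
  · exact absurd hxx (hcross v x')
  · exact absurd hxx.symm (hcross v' x)
  · obtain ⟨h1, h2⟩ := List.cons.inj hxx
    obtain ⟨h3, h4⟩ := Prod.mk.inj h1
    refine congrArg _ (Subtype.ext (Prod.ext (Prod.ext ?_ h3) h4))
    exact Subtype.ext (h.injective_even h2)

/-- Recording what each even vertex of the image draws, with `none` for anything outside the image,
splits the event into boxes, whose probabilities are products. -/
theorem isBallEmbedding_iff_exists_covering (h : IsBigEmbedding o par ht ψ e f) [Finite α]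
    (hT : IsRooted T o par ht)
    (hodd : ∀ v, Odd (ht v) → Nat.card (childSet o par v) = k)
    {ω : EvenVertex k d → OddVertex k d} (hω : ∀ w, ω w ∈ evenNbrs w) :
    IsBallEmbedding o par ht (.inl []) bigParent (oneOutVerts ω) r ψ ↔
      ∃ g, IsCovering ht r g ∧ ∀ i, ω (drawPos (r := r) e f i) ∈ drawBox e f g i := by
  classical
  rw [h.isBallEmbedding_iff_of_mem_evenNbrs hT hodd hω]
  constructor
  · rintro ⟨h1, h2, h3⟩
    have hex : ∀ v : EvenPart ht, ∃ x : Option (OddPart ht), ω (e v) ∈ drawSet f x := by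
      intro v
      by_cases hv : ω (e v) ∈ Set.range f
      · obtain ⟨u, hu⟩ := hv
        exact ⟨some u, hu.symm⟩
      · exact ⟨none, hv⟩
    choose g hg using hex
    have hsome : ∀ v u, ω (e v) = f u → g v = some u := by
      intro v u hvu
      have := hg v
      rcases hgv : g v with _ | u'
      · rw [hgv] at this
        exact absurd ⟨u, hvu.symm⟩ this
      · rw [hgv] at this
        have : ω (e v) = f u' := this
        rw [h.injective_odd (this.symm.trans hvu)]
    refine ⟨g, ⟨fun u => ?_, fun v hv => ?_⟩, ?_⟩
    · obtain ⟨v, hv⟩ := h3 u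
      exact ⟨v, hsome v u hv⟩
    · obtain ⟨u, hu⟩ := h2 v hv
      rw [hsome v u hu.symm]
      simp
    · rintro (v | x)
      · exact hg v
      · exact h1 x
  · rintro ⟨g, ⟨hg1, hg2⟩, hbox⟩
    refine ⟨fun x => hbox (.inr x), fun v hv => ?_, fun u => ?_⟩
    · obtain ⟨u, hu⟩ := Option.ne_none_iff_exists'.1 (hg2 v hv)
      have := hbox (.inl v)
      simp only [drawBox, hu, drawSet] at this
      exact ⟨u, this.symm⟩
    · obtain ⟨v, hv⟩ := hg1 u
      have := hbox (.inl v)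
      simp only [drawBox, hv, drawSet] at this
      exact ⟨v, this⟩

/-- The inner even vertices have `|I| d` children in `𝐓_{k,d}`. Exactly `|U|` of them are in the
image, each identified by its parent and index, and each of the others has `k` children. -/
theorem card_outerVertex [Fintype α] (h : IsBigEmbedding o par ht ψ e f)
    (hT : IsRooted T o par ht) (hr : ∀ v, ht v ≤ r) :
    Nat.card (OuterVertex ht r e f) =
      (Nat.card {v : EvenPart ht // ht v < r} * d - Nat.card (OddPart ht)) * k := by
  classical
  let p : {v : EvenPart ht // ht v < r} × Fin d → Prop := fun y =>
    (⟨e y.1, y.2⟩ : OddVertex k d) ∈ Set.range f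
  have hp : Nat.card {y // p y} = Nat.card (OddPart ht) := by
    refine (Nat.card_congr (Equiv.ofBijective (fun u : OddPart ht =>
      (⟨(⟨⟨par u, even_parent hT u.2⟩, depth_parent_lt hT hr (hT.ne_root_of_depth fun e => by
        have := u.2
        simp [e] at this)⟩, (f u).index), ⟨u, OddVertex.ext (h.parent_odd hT u) rfl⟩⟩ :
        {y // p y})) ⟨?_, ?_⟩)).symm
    · intro u u' huu
      have h1 := congrArg (fun y => y.1) huu
      have h2 := congrArg Prod.snd h1
      have h3 := congrArg Subtype.val (congrArg Prod.fst h1)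
      refine h.injective_odd (OddVertex.ext ?_ h2)
      rw [h.parent_odd hT, h.parent_odd hT]
      exact congrArg e h3
    · rintro ⟨⟨⟨v, hv⟩, i⟩, u, hu⟩
      refine ⟨u, Subtype.ext (Prod.ext (Subtype.ext (h.injective_even ?_)) ?_)⟩
      · rw [← h.parent_odd hT, hu]
      · exact congrArg OddVertex.index hu
  have hnp : Nat.card {y // ¬ p y} =
      Nat.card {v : EvenPart ht // ht v < r} * d - Nat.card (OddPart ht) := by
    rw [← hp, Nat.card_eq_fintype_card, Fintype.card_subtype_compl, ← Nat.card_eq_fintype_card,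
      ← Nat.card_eq_fintype_card, Nat.card_prod, Nat.card_fin]
  rw [← hnp]
  have : OuterVertex ht r e f ≃ {y // ¬ p y} × Fin k :=
    Equiv.prodSubtypeFstEquivSubtypeProd (p := fun y => ¬ p y)
  rw [Nat.card_congr this, Nat.card_prod, Nat.card_fin]

open scoped Classical in
theorem measureReal_drawBox [Fintype α] [NeZero d] (h : IsBigEmbedding o par ht ψ e f)
    (hT : IsRooted T o par ht) (hr : ∀ v, ht v ≤ r) (g : EvenPart ht → Option (OddPart ht)) :
    (drawLaw k d).real {ω | ∀ i, ω (drawPos (r := r) e f i) ∈ drawBox e f g i} =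
      (1 - ((d : ℝ) + 1)⁻¹) ^
        ((Nat.card {v : EvenPart ht // ht v < r} * d - Nat.card (OddPart ht)) * k) *
      ∏ v : EvenPart ht, optDrawProb T o ht d v (g v) := by
  rw [measureReal_def, drawLaw, infinitePi_cylinder_of_injective _ (h.drawPos_injective hT)
    (fun _ => MeasurableSet.of_discrete), ENNReal.toReal_prod, Fintype.prod_sum_type, mul_comm]
  congr 1
  · have : ∀ x : OuterVertex ht r e f,
        (uniformOn (evenNbrs (drawPos (r := r) e f (.inr x)))
          (drawBox e f g (.inr x))).toReal = 1 - ((d : ℝ) + 1)⁻¹ := by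
      intro x
      rw [← measureReal_def, drawBox, probReal_compl_eq_one_sub MeasurableSet.of_discrete,
        uniformOn_evenNbrs_real_singleton, if_pos, if_neg]
      -- An outer vertex is not the root, so it has `d + 1` neighbours.
      · simp [drawPos]
      · exact (mem_evenNbrs _ _).2 (Or.inr ⟨_, rfl⟩)
    rw [Finset.prod_congr rfl fun x _ => this x, Finset.prod_const, Finset.card_univ,
      ← Nat.card_eq_fintype_card, h.card_outerVertex hT hr]
  · exact Finset.prod_congr rfl fun v _ => h.measureReal_drawSet hT v (g v)

theorem ballEmbedding_ae_eq [Finite α] [NeZero d] (h : IsBigEmbedding o par ht ψ e f)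
    (hT : IsRooted T o par ht)
    (hodd : ∀ v, Odd (ht v) → Nat.card (childSet o par v) = k) :
    {ω | IsBallEmbedding o par ht (.inl []) bigParent (oneOutVerts ω) r ψ} =ᵐ[drawLaw k d]
      (⋃ g ∈ {g | IsCovering ht r g},
        {ω | ∀ i, ω (drawPos (r := r) e f i) ∈ drawBox e f g i} : Set _) := by
  rw [Filter.eventuallyEq_set]
  filter_upwards [ae_mem_evenNbrs (k := k) (d := d)] with ω hω
  refine (h.isBallEmbedding_iff_exists_covering hT hodd hω).trans ?_
  simp only [Set.mem_iUnion, exists_prop]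
  rfl

end IsBigEmbedding

end Patterns

/-! ### The ball probability of the 1-out model for fixed `d` -/

section OneOutFormula

variable {α : Type*} {T : SimpleGraph α} {o : α} {par : α → α} {ht : α → ℕ} {k d r : ℕ}

theorem IsBigEmbedding.nullMeasurableSet_ballEmbedding [Finite α] [NeZero d]
    {ψ : α → EvenVertex k d ⊕ OddVertex k d} {e : EvenPart ht → EvenVertex k d}
    {f : OddPart ht → OddVertex k d} (h : IsBigEmbedding o par ht ψ e f)
    (hT : IsRooted T o par ht) (hodd : ∀ v, Odd (ht v) → Nat.card (childSet o par v) = k) :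
    NullMeasurableSet {ω | IsBallEmbedding o par ht (.inl []) bigParent (oneOutVerts ω) r ψ}
      (drawLaw k d) := by
  refine NullMeasurableSet.congr (MeasurableSet.nullMeasurableSet ?_)
    (h.ballEmbedding_ae_eq hT hodd).symm
  exact MeasurableSet.biUnion (Set.to_countable _) fun g _ =>
    measurableSet_cylinder _ fun _ => MeasurableSet.of_discrete

open scoped Classical in
theorem IsBigEmbedding.measureReal_ballEmbedding [Fintype α] [NeZero d]
    {ψ : α → EvenVertex k d ⊕ OddVertex k d} {e : EvenPart ht → EvenVertex k d}
    {f : OddPart ht → OddVertex k d} (h : IsBigEmbedding o par ht ψ e f)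
    (hT : IsRooted T o par ht) (hr : ∀ v, ht v ≤ r)
    (hodd : ∀ v, Odd (ht v) → Nat.card (childSet o par v) = k) :
    (drawLaw k d).real
        {ω | IsBallEmbedding o par ht (.inl []) bigParent (oneOutVerts ω) r ψ} =
      (1 - ((d : ℝ) + 1)⁻¹) ^
        ((Nat.card {v : EvenPart ht // ht v < r} * d - Nat.card (OddPart ht)) * k) *
      ∑ g ∈ Finset.univ.filter (IsCovering ht r),
        ∏ v : EvenPart ht, optDrawProb T o ht d v (g v) := by
  have hset : {g : EvenPart ht → Option (OddPart ht) | IsCovering ht r g} =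
      ((Finset.univ.filter (IsCovering ht r) : Finset _) : Set _) := by
    ext g; simp
  rw [measureReal_congr (h.ballEmbedding_ae_eq hT hodd), hset, Finset.mul_sum]
  simp only [Finset.mem_coe]
  rw [measureReal_biUnion_finset]
  · exact Finset.sum_congr rfl fun g _ => h.measureReal_drawBox hT hr g
  · intro g _ g' _ hgg
    -- Boxes of different patterns are disjoint, since the draw of `e v` determines `g v`.
    refine Set.disjoint_left.2 fun ω hω hω' => hgg ?_
    funext v
    have h1 := hω (.inl v)
    have h2 := hω' (.inl v)
    simp only [IsBigEmbedding.drawBox] at h1 h2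
    rcases hg : g v with _ | u <;> rcases hg' : g' v with _ | u'
    · rfl
    · rw [hg] at h1
      rw [hg'] at h2
      exact absurd ⟨u', h2.symm⟩ h1
    · rw [hg] at h1
      rw [hg'] at h2
      exact absurd ⟨u, h1.symm⟩ h2
    · rw [hg] at h1
      rw [hg'] at h2
      rw [h.injective_odd (h1.symm.trans h2)]
  · exact fun g _ => measurableSet_cylinder _ fun _ => MeasurableSet.of_discrete

theorem ballIso_oneOutGraph_iff (hT : IsRooted T o par ht) (hr : ∀ v, ht v ≤ r)
    (ω : EvenVertex k d → OddVertex k d) : BallIso (oneOutGraph ω) (oneOutRoot ω) r T o ↔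
      ∃ ψ, IsBallEmbedding o par ht (.inl []) bigParent (oneOutVerts ω) r ψ :=
  ballIso_iff_exists_isBallEmbedding isRooted_bigTree hT hr (oneOutRoot ω).2

theorem ncard_isBallEmbedding_oneOutGraph (hT : IsRooted T o par ht) (hr : ∀ v, ht v ≤ r)
    (ω : EvenVertex k d → OddVertex k d)
    (h : BallIso (oneOutGraph ω) (oneOutRoot ω) r T o) :
    {ψ | IsBallEmbedding o par ht (.inl []) bigParent (oneOutVerts ω) r ψ}.ncard = numAut T o :=
  ncard_isBallEmbedding isRooted_bigTree hT hr (oneOutRoot ω).2 h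

open scoped Classical in
theorem numAut_mul_oneOutBallProb [Fintype α] [NeZero d] (hT : IsRooted T o par ht)
    (hr : ∀ v, ht v ≤ r) (hodd : ∀ v, Odd (ht v) → Nat.card (childSet o par v) = k)
    (hd : Fintype.card α ≤ d) :
    (numAut T o : ℝ) * oneOutBallProb k d r T o =
      ((∏ v, (if Even (ht v) then d else k).descFactorial (Nat.card (childSet o par v)) : ℕ) : ℝ) *
      ((1 - ((d : ℝ) + 1)⁻¹) ^
        ((Nat.card {v : EvenPart ht // ht v < r} * d - Nat.card (OddPart ht)) * k) *
      ∑ g ∈ Finset.univ.filter (IsCovering ht r),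
        ∏ v : EvenPart ht, optDrawProb T o ht d v (g v)) := by
  have hfin : (bigMaps k d o par).Finite := by
    -- Finiteness again comes from a nonzero count; `d ≥ |α|` keeps the falling factorials at even
    -- vertices from vanishing.
    apply Set.finite_of_ncard_ne_zero
    rw [ncard_bigMaps hT]
    refine Finset.prod_ne_zero_iff.2 fun v _ => ?_
    rw [Ne, Nat.descFactorial_eq_zero_iff_lt, not_lt]
    split_ifs with hv
    · refine le_trans ?_ hd
      rw [Nat.card_eq_fintype_card]
      exact Fintype.card_subtype_le _
    · exact (hodd v (Nat.not_even_iff_odd.1 hv)).le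
  have hs : ∀ ψ, ψ ∈ hfin.toFinset ↔ ψ ∈ bigMaps k d o par := fun ψ => hfin.mem_toFinset
  have hbig : ∀ ψ ∈ hfin.toFinset, ∃ (e : EvenPart ht → EvenVertex k d)
      (f : OddPart ht → OddVertex k d), IsBigEmbedding o par ht ψ e f := by
    intro ψ hψ
    obtain ⟨h1, h2⟩ := (hs ψ).1 hψ
    obtain ⟨e, f, he, hf⟩ := exists_even_odd_parts hT h1
    exact ⟨e, f, h1, h2, he, hf⟩
  have hcount := nsmul_measureReal_eq_sum (drawLaw k d) hfin.toFinset
    (fun ψ => {ω | IsBallEmbedding o par ht (.inl []) bigParent (oneOutVerts ω) r ψ})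
    {ω | BallIso (oneOutGraph ω) (oneOutRoot ω) r T o} (numAut T o) (numAut_pos T o)
    (by
      intro ψ hψ
      obtain ⟨e, f, h⟩ := hbig ψ hψ
      exact h.nullMeasurableSet_ballEmbedding hT hodd)
    (by
      intro ω hω
      rw [← ncard_isBallEmbedding_oneOutGraph hT hr ω hω]
      congr 1
      ext ψ
      refine ⟨fun h => h.2, fun h => ⟨(hs ψ).2 ⟨h.isRootedMap, h.injective⟩, h⟩⟩)
    (by
      intro ψ _ ω hω
      exact (ballIso_oneOutGraph_iff hT hr ω).2 ⟨ψ, hω⟩)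
  rw [oneOutBallProb, hcount]
  have hconst := Finset.sum_congr (rfl : hfin.toFinset = _) fun ψ hψ => by
    obtain ⟨e, f, h⟩ := hbig ψ hψ
    exact h.measureReal_ballEmbedding (r := r) hT hr hodd
  rw [hconst, Finset.sum_const, nsmul_eq_mul, ← Set.ncard_eq_toFinset_card _ hfin,
    ncard_bigMaps hT]

end OneOutFormula

/-! ### Matchings as patterns of draws -/

section Patterns

variable {α : Type*} {T : SimpleGraph α} {o : α} {par : α → α} {ht : α → ℕ} {k r : ℕ}

/-- The patterns of draws which come from matchings. -/
structure IsMatchingPattern (T : SimpleGraph α) (ht : α → ℕ) (r : ℕ)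
    (g : EvenPart ht → Option (OddPart ht)) : Prop where
  covering : IsCovering ht r g
  adj : ∀ v u, g v = some u → T.Adj v u
  injective : ∀ v v' u, g v = some u → g v' = some u → v = v'

/-- The subgraph with the edges prescribed by a pattern of draws. -/
def patternSubgraph (g : EvenPart ht → Option (OddPart ht))
    (hg : ∀ v u, g v = some u → T.Adj v u) : T.Subgraph where
  verts := {a | ∃ v u, g v = some u ∧ (a = v ∨ a = u)}
  Adj a b := ∃ v u, g v = some u ∧ ((a = v ∧ b = u) ∨ (a = u ∧ b = v))
  adj_sub := by
    rintro a b ⟨v, u, h, ⟨rfl, rfl⟩ | ⟨rfl, rfl⟩⟩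
    · exact hg v u h
    · exact (hg v u h).symm
  edge_vert := by
    rintro a b ⟨v, u, h, ⟨rfl, rfl⟩ | ⟨rfl, rfl⟩⟩
    · exact ⟨v, u, h, Or.inl rfl⟩
    · exact ⟨v, u, h, Or.inr rfl⟩
  symm := by
    constructor
    rintro a b ⟨v, u, h, h' | h'⟩
    · exact ⟨v, u, h, Or.inr h'.symm⟩
    · exact ⟨v, u, h, Or.inl h'.symm⟩

theorem coe_even_ne_coe_odd (v : EvenPart ht) (u : OddPart ht) : (v : α) ≠ u := fun h =>
  Nat.not_even_iff_odd.2 u.2 (h ▸ v.2)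

theorem patternSubgraph_adj {g : EvenPart ht → Option (OddPart ht)}
    (hg : ∀ v u, g v = some u → T.Adj v u) (v : EvenPart ht) (u : OddPart ht) :
    (patternSubgraph g hg).Adj v u ↔ g v = some u := by
  constructor
  · rintro ⟨v', u', h, ⟨h1, h2⟩ | ⟨h1, h2⟩⟩
    · rwa [Subtype.ext h1, Subtype.ext h2]
    · exact absurd h1 (coe_even_ne_coe_odd v u')
  · exact fun h => ⟨v, u, h, Or.inl ⟨rfl, rfl⟩⟩

theorem odd_of_adj_even (hT : IsRooted T o par ht) {v u : α} (h : T.Adj v u) :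
    Even (ht v) ↔ Odd (ht u) := by
  rcases (hT.adj_iff _ _).1 h with ⟨hu, rfl⟩ | ⟨hv, rfl⟩
  · rw [hT.depth_eq u hu, Nat.odd_add_one, Nat.not_odd_iff_even]
  · rw [hT.depth_eq v hv, Nat.even_add_one, Nat.not_even_iff_odd]

/-- Edges join even to odd vertices, so a matching is a partial function from even to odd vertices
that is injective where defined. Since `r` is even, all odd vertices have height less than `r`, and
saturating them means that all are drawn. -/
theorem ncard_matchingPatterns (hT : IsRooted T o par ht) (hr : ∀ v, ht v ≤ r) (heven : Even r) :
    {g : EvenPart ht → Option (OddPart ht) | IsMatchingPattern T ht r g}.ncard =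
      {M : T.Subgraph | M.IsMatching ∧ {v | ht v < r} ⊆ M.verts}.ncard := by
  classical
  refine Set.ncard_congr (fun g hg => patternSubgraph g hg.adj) ?_ ?_ ?_
  · intro g hg
    refine ⟨?_, ?_⟩
    · rintro a ⟨v, u, h, rfl | rfl⟩
      · refine ⟨u, ⟨v, u, h, Or.inl ⟨rfl, rfl⟩⟩, ?_⟩
        rintro b ⟨v', u', h', ⟨h1, rfl⟩ | ⟨h1, -⟩⟩
        · rw [Subtype.ext h1, h'] at h
          rw [Option.some.inj h]
        · exact absurd h1 (coe_even_ne_coe_odd v u')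
      · refine ⟨v, ⟨v, u, h, Or.inr ⟨rfl, rfl⟩⟩, ?_⟩
        rintro b ⟨v', u', h', ⟨h1, -⟩ | ⟨h1, rfl⟩⟩
        · exact absurd h1.symm (coe_even_ne_coe_odd v' u)
        · rw [← Subtype.ext h1] at h'
          rw [hg.injective _ _ _ h' h]
    · intro a ha
      rcases Nat.even_or_odd (ht a) with he | ho
      · obtain ⟨u, hu⟩ := Option.ne_none_iff_exists'.1 (hg.covering.2 ⟨a, he⟩ ha)
        exact ⟨_, u, hu, Or.inl rfl⟩
      · obtain ⟨v, hv⟩ := hg.covering.1 ⟨a, ho⟩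
        exact ⟨v, _, hv, Or.inr rfl⟩
  · intro g g' hg hg' h
    funext v
    refine Option.ext fun u => ?_
    have h1 := patternSubgraph_adj hg.adj v u
    rw [h, patternSubgraph_adj hg'.adj] at h1
    exact h1.symm
  · rintro M ⟨hM, hsat⟩
    let g : EvenPart ht → Option (OddPart ht) := fun v =>
      if h : ∃ u : OddPart ht, M.Adj v u then some h.choose else none
    have hgM : ∀ v u, g v = some u ↔ M.Adj v u := by
      intro v u
      constructor
      · intro h
        by_cases hex : ∃ u : OddPart ht, M.Adj v u
        · simp only [g, hex, dite_true, Option.some.injEq] at h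
          rw [← h]
          exact hex.choose_spec
        · simp only [g, dif_neg hex] at h
          cases h
      · intro h
        have hex : ∃ u : OddPart ht, M.Adj v u := ⟨u, h⟩
        simp only [g, hex, dite_true, Option.some.injEq]
        exact Subtype.ext (hM.eq_of_adj_left hex.choose_spec h)
    have hpart : ∀ a b, M.Adj a b → ∃ v u, g v = some u ∧ ((a = v ∧ b = u) ∨ (a = u ∧ b = v)) := by
      intro a b hab
      have hpar := odd_of_adj_even hT hab.adj_sub
      rcases Nat.even_or_odd (ht a) with he | ho
      · exact ⟨⟨a, he⟩, ⟨b, hpar.1 he⟩, (hgM _ _).2 hab, Or.inl ⟨rfl, rfl⟩⟩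
      · have hb : Even (ht b) := by
          rw [← Nat.not_odd_iff_even, ← hpar]
          exact Nat.not_even_iff_odd.2 ho
        exact ⟨⟨b, hb⟩, ⟨a, ho⟩, (hgM _ _).2 hab.symm, Or.inr ⟨rfl, rfl⟩⟩
    have hgp : IsMatchingPattern T ht r g := by
      refine ⟨⟨fun u => ?_, fun v hv => ?_⟩, fun v u h => ((hgM v u).1 h).adj_sub,
        fun v v' u h h' => ?_⟩
      · have hu : ht u < r := lt_of_le_of_ne (hr u) fun e =>
          Nat.not_odd_iff_even.2 heven (e ▸ u.2)
        obtain ⟨b, hb, -⟩ := hM (hsat hu)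
        obtain ⟨v, u', h, ⟨h1, -⟩ | ⟨h1, -⟩⟩ := hpart _ _ hb
        · exact absurd h1.symm (coe_even_ne_coe_odd v u)
        · exact ⟨v, by rw [h, Subtype.ext h1]⟩
      · obtain ⟨b, hb, -⟩ := hM (hsat hv)
        obtain ⟨v', u', h, ⟨h1, -⟩ | ⟨h1, -⟩⟩ := hpart _ _ hb
        · rw [Subtype.ext h1, h]; simp
        · exact absurd h1 (coe_even_ne_coe_odd v u')
      · exact Subtype.ext (hM.eq_of_adj_right ((hgM _ _).1 h) ((hgM _ _).1 h'))
    refine ⟨g, hgp, ?_⟩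
    have hadj : (patternSubgraph g hgp.adj).Adj = M.Adj := by
      funext a b
      apply propext
      constructor
      · rintro ⟨v, u, h, ⟨rfl, rfl⟩ | ⟨rfl, rfl⟩⟩
        · exact (hgM v u).1 h
        · exact ((hgM v u).1 h).symm
      · exact hpart a b
    refine SimpleGraph.Subgraph.ext ?_ hadj
    rw [← hM.support_eq_verts]
    ext a
    rw [SimpleGraph.Subgraph.mem_support]
    constructor
    · rintro ⟨v, u, h, rfl | rfl⟩
      · exact ⟨u, (hgM v u).1 h⟩
      · exact ⟨v, ((hgM v u).1 h).symm⟩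
    · rintro ⟨b, hb⟩
      obtain ⟨v, u, h, ⟨h1, -⟩ | ⟨h1, -⟩⟩ := hpart a b hb
      · exact ⟨v, u, h, Or.inl h1⟩
      · exact ⟨v, u, h, Or.inr h1⟩

/-- The number of vertices which draw a vertex of the tree. -/
noncomputable def numDraws (g : EvenPart ht → Option (OddPart ht)) : ℕ :=
  Nat.card {v // g v ≠ none}

theorem exists_surjective_of_covering {g : EvenPart ht → Option (OddPart ht)}
    (hg : IsCovering ht r g) : ∃ F : {v // g v ≠ none} → OddPart ht, F.Surjective ∧
      ∀ v : {v // g v ≠ none}, g v = some (F v) := by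
  choose F hF using fun v : {v // g v ≠ none} => Option.ne_none_iff_exists'.1 v.2
  refine ⟨F, fun u => ?_, hF⟩
  obtain ⟨v, hv⟩ := hg.1 u
  have hne : g v ≠ none := by rw [hv]; simp
  exact ⟨⟨v, hne⟩, Option.some.inj ((hF ⟨v, hne⟩).symm.trans hv)⟩

theorem card_oddPart_le_numDraws [Finite α] {g : EvenPart ht → Option (OddPart ht)}
    (hg : IsCovering ht r g) : Nat.card (OddPart ht) ≤ numDraws g := by
  obtain ⟨F, hF, -⟩ := exists_surjective_of_covering hg
  exact Nat.card_le_card_of_surjective F hF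

/-- A covering pattern is a surjection from the drawing vertices onto the odd ones; it is injective
exactly when the two cardinalities agree. -/
theorem isMatchingPattern_iff [Finite α] {g : EvenPart ht → Option (OddPart ht)}
    (hg : IsCovering ht r g) : IsMatchingPattern T ht r g ↔
      (∀ v u, g v = some u → T.Adj v u) ∧ numDraws g = Nat.card (OddPart ht) := by
  obtain ⟨F, hF, hgF⟩ := exists_surjective_of_covering hg
  constructor
  · intro h
    refine ⟨h.adj, Nat.card_eq_of_bijective F ⟨fun v v' hvv => ?_, hF⟩⟩
    exact Subtype.ext (h.injective _ _ _ (hgF v) ((hgF v').trans (by rw [hvv])))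
  · rintro ⟨h1, h2⟩
    refine ⟨hg, h1, fun v v' u hv hv' => ?_⟩
    have hbij := hF.bijective_of_nat_card_le h2.le
    have hne : g v ≠ none := by rw [hv]; simp
    have hne' : g v' ≠ none := by rw [hv']; simp
    have e1 := Option.some.inj ((hgF ⟨v, hne⟩).symm.trans hv)
    have e2 := Option.some.inj ((hgF ⟨v', hne'⟩).symm.trans hv')
    exact congrArg Subtype.val (hbij.1 (e1.trans e2.symm))

end Patterns

/-! ### Asymptotics as `d → ∞` -/

section Limits

variable {α : Type*} {T : SimpleGraph α} {o : α} {par : α → α} {ht : α → ℕ} {k r : ℕ}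

theorem tendsto_inv_natCast_add_one :
    Tendsto (fun d : ℕ => ((d : ℝ) + 1)⁻¹) atTop (𝓝 0) := by
  simpa [one_div] using tendsto_one_div_add_atTop_nhds_zero_nat (𝕜 := ℝ)

theorem tendsto_mul_inv_natCast_add_one :
    Tendsto (fun d : ℕ => (d : ℝ) * ((d : ℝ) + 1)⁻¹) atTop (𝓝 1) := by
  have h : Tendsto (fun d : ℕ => 1 - ((d : ℝ) + 1)⁻¹) atTop (𝓝 (1 - 0)) :=
    tendsto_const_nhds.sub tendsto_inv_natCast_add_one
  rw [sub_zero] at h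
  refine h.congr fun d => ?_
  have : (d : ℝ) + 1 ≠ 0 := by positivity
  field_simp
  ring

theorem tendsto_drawProb (v u : α) :
    Tendsto (fun d : ℕ => drawProb T o d v u) atTop (𝓝 0) := by
  classical
  unfold drawProb
  split_ifs with h1 h2
  · exact tendsto_inv_atTop_nhds_zero_nat
  · exact tendsto_inv_natCast_add_one
  · exact tendsto_const_nhds

open scoped Classical in
theorem tendsto_mul_drawProb (v u : α) :
    Tendsto (fun d : ℕ => (d : ℝ) * drawProb T o d v u) atTop
      (𝓝 (if T.Adj v u then 1 else 0)) := by
  unfold drawProb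
  split_ifs with h1 h2
  · refine tendsto_const_nhds.congr' ?_
    filter_upwards [eventually_ne_atTop 0] with d hd
    rw [mul_inv_cancel₀ (by exact_mod_cast hd)]
  · exact tendsto_mul_inv_natCast_add_one
  · simp

open scoped Classical in
theorem tendsto_pow_mul_optDrawProb [Fintype α] (v : α) (x : Option (OddPart ht)) :
    Tendsto (fun d : ℕ => (if x ≠ none then (d : ℝ) else 1) * optDrawProb T o ht d v x) atTop
      (𝓝 (if ∀ u, x = some u → T.Adj v u then 1 else 0)) := by
  rcases x with _ | u
  · have h : Tendsto (fun d : ℕ => 1 - ∑ u : OddPart ht, drawProb T o d v u) atTop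
        (𝓝 (1 - ∑ _u : OddPart ht, 0)) :=
      tendsto_const_nhds.sub (tendsto_finsetSum _ fun u _ => tendsto_drawProb v (u : α))
    simpa [optDrawProb] using h
  · simpa [optDrawProb] using tendsto_mul_drawProb (T := T) (o := o) v (u : α)

-- A pattern with `n` draws inside the image has probability of order at most `d^{-n}`, and covering
-- forces `n ≥ |U|`. Surplus draws make the rescaled limit zero; with `n = |U|` the limit is 1 if
-- all draws go to neighbours and 0 otherwise.
open scoped Classical in
theorem tendsto_pow_mul_prod_optDrawProb [Fintype α] {g : EvenPart ht → Option (OddPart ht)}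
    (hg : IsCovering ht r g) :
    Tendsto (fun d : ℕ => (d : ℝ) ^ Nat.card (OddPart ht) *
        ∏ v : EvenPart ht, optDrawProb T o ht d v (g v)) atTop
      (𝓝 (if IsMatchingPattern T ht r g then 1 else 0)) := by
  have hprod : Tendsto (fun d : ℕ => (d : ℝ) ^ numDraws g *
        ∏ v : EvenPart ht, optDrawProb T o ht d v (g v)) atTop
      (𝓝 (∏ v : EvenPart ht, if ∀ u, g v = some u → T.Adj v u then 1 else 0)) := by
    have := tendsto_finsetProd (Finset.univ : Finset (EvenPart ht)) fun v _ =>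
      tendsto_pow_mul_optDrawProb (T := T) (o := o) (v : α) (g v)
    refine this.congr fun d => ?_
    rw [Finset.prod_mul_distrib, Finset.prod_ite, Finset.prod_const, Finset.prod_const_one, mul_one,
      numDraws, Nat.card_eq_fintype_card, Fintype.card_subtype]
  by_cases hcard : numDraws g = Nat.card (OddPart ht)
  · rw [hcard] at hprod
    convert hprod using 2
    rw [Finset.prod_boole]
    simp only [isMatchingPattern_iff hg, hcard, and_true, Finset.mem_univ, true_imp_iff]
  · have hlt : Nat.card (OddPart ht) < numDraws g :=
      lt_of_le_of_ne (card_oddPart_le_numDraws hg) (Ne.symm hcard)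
    rw [if_neg fun h => hcard ((isMatchingPattern_iff hg).1 h).2]
    have hinv : Tendsto (fun d : ℕ => ((d : ℝ) ^ (numDraws g - Nat.card (OddPart ht)))⁻¹) atTop
        (𝓝 0) :=
      ((tendsto_pow_atTop (by omega)).comp tendsto_natCast_atTop_atTop).inv_tendsto_atTop
    have := hinv.mul hprod
    rw [zero_mul] at this
    refine this.congr' ?_
    filter_upwards [eventually_ne_atTop 0] with d hd
    have hd : (d : ℝ) ≠ 0 := by exact_mod_cast hd
    rw [← mul_assoc]
    congr 1
    rw [inv_mul_eq_div, div_eq_iff (pow_ne_zero _ hd), ← pow_add]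
    congr 1
    omega

open scoped Classical in
theorem tendsto_pow_mul_sum_coverings [Fintype α] (hT : IsRooted T o par ht) (hr : ∀ v, ht v ≤ r)
    (heven : Even r) :
    Tendsto (fun d : ℕ => (d : ℝ) ^ Nat.card (OddPart ht) *
        ∑ g ∈ Finset.univ.filter (IsCovering ht r),
          ∏ v : EvenPart ht, optDrawProb T o ht d v (g v)) atTop
      (𝓝 ({M : T.Subgraph | M.IsMatching ∧ {v | ht v < r} ⊆ M.verts}.ncard : ℝ)) := by
  simp only [Finset.mul_sum]
  have := tendsto_finsetSum (Finset.univ.filter (IsCovering ht r)) fun g hg =>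
    tendsto_pow_mul_prod_optDrawProb (T := T) (o := o) (Finset.mem_filter.1 hg).2
  convert this using 2
  rw [← ncard_matchingPatterns hT hr heven, Finset.sum_boole, Finset.filter_filter]
  congr 1
  rw [← Set.ncard_coe_finset]
  congr 1
  ext g
  simpa using fun h : IsMatchingPattern T ht r g => h.covering

theorem tendsto_one_sub_inv_pow (a b c : ℕ) :
    Tendsto (fun d : ℕ => (1 - ((d : ℝ) + 1)⁻¹) ^ ((a * d - b) * c)) atTop
      (𝓝 (Real.exp (-((c : ℝ) * a)))) := by
  have hbase : Tendsto (fun d : ℕ => 1 - ((d : ℝ) + 1)⁻¹) atTop (𝓝 1) := by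
    simpa using (tendsto_const_nhds (x := (1 : ℝ))).sub tendsto_inv_natCast_add_one
  have hexp : Tendsto (fun d : ℕ => (1 - ((d : ℝ) + 1)⁻¹) ^ d) atTop (𝓝 (Real.exp (-1))) := by
    simp only [sub_eq_add_neg]
    refine Real.tendsto_one_add_pow_exp_of_tendsto ?_
    simpa using tendsto_mul_inv_natCast_add_one.neg
  have key : Tendsto (fun d : ℕ => (1 - ((d : ℝ) + 1)⁻¹) ^ (a * d - b)) atTop
      (𝓝 (Real.exp (-1) ^ a)) := by
    rcases Nat.eq_zero_or_pos a with rfl | ha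
    · simp
    · have h1 := (hexp.pow a).mul ((hbase.pow b).inv₀ (by simp))
      rw [one_pow, inv_one, mul_one] at h1
      refine h1.congr' ?_
      -- For such `d` the base is nonzero and `b ≤ a * d`, so the subtraction in the exponent is not
      -- truncated.
      filter_upwards [eventually_ge_atTop (b + 1)] with d hd
      have hne : 1 - ((d : ℝ) + 1)⁻¹ ≠ 0 := by
        have hd0 : (0 : ℝ) < d := by
          have : 0 < d := by omega
          exact_mod_cast this
        have : 1 - ((d : ℝ) + 1)⁻¹ = d / (d + 1) := by field_simp; ring
        rw [this]
        positivity
      have hle : b ≤ a * d := by nlinarith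
      rw [pow_sub₀ _ hne hle, ← pow_mul, mul_comm d a]
  have h := key.pow c
  simp only [← pow_mul] at h
  convert h using 2
  rw [← Real.exp_nat_mul]
  congr 1
  push_cast
  ring

theorem tendsto_descFactorial_div_pow (c : ℕ) :
    Tendsto (fun d : ℕ => (d.descFactorial c : ℝ) / (d : ℝ) ^ c) atTop (𝓝 1) := by
  refine (Asymptotics.isEquivalent_iff_tendsto_one ?_).1 (isEquivalent_descFactorial c)
  filter_upwards [eventually_ne_atTop 0] with d hd
  exact pow_ne_zero _ (by exact_mod_cast hd)

theorem sum_card_childSet_even [Fintype α] (hT : IsRooted T o par ht) :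
    ∑ v : EvenPart ht, Nat.card (childSet o par (v : α)) = Nat.card (OddPart ht) := by
  classical
  rw [← Nat.card_sigma]
  refine Nat.card_congr (Equiv.ofBijective (fun x : Σ v : EvenPart ht, childSet o par (v : α) =>
    (⟨x.2, ?_⟩ : OddPart ht)) ⟨?_, ?_⟩)
  · rw [hT.depth_eq _ x.2.2.1, x.2.2.2]
    exact x.1.2.add_one
  · rintro ⟨⟨v, hv⟩, ⟨c, hc⟩⟩ ⟨⟨v', hv'⟩, ⟨c', hc'⟩⟩ h
    obtain rfl : c = c' := congrArg Subtype.val h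
    obtain rfl : v = v' := hc.2.symm.trans hc'.2
    rfl
  · rintro ⟨u, hu⟩
    exact ⟨⟨⟨par u, even_parent hT hu⟩,
      ⟨u, hT.ne_root_of_depth fun e => by simp [e] at hu, rfl⟩⟩, rfl⟩

/-- An even vertex with `c` children contributes a falling factorial asymptotic to `d^c`, and these
exponents add up to `|U|` because each odd vertex has one even parent. An odd vertex contributes
`k!`. -/
theorem tendsto_card_bigMaps_div_pow [Fintype α] (hT : IsRooted T o par ht)
    (hodd : ∀ v, Odd (ht v) → Nat.card (childSet o par v) = k) :
    Tendsto (fun d : ℕ =>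
        ((∏ v, (if Even (ht v) then d else k).descFactorial (Nat.card (childSet o par v)) : ℕ) : ℝ) /
          (d : ℝ) ^ Nat.card (OddPart ht)) atTop
      (𝓝 ((k.factorial : ℝ) ^ Nat.card (OddPart ht))) := by
  classical
  have hsplit : ∀ d : ℕ,
      ((∏ v, (if Even (ht v) then d else k).descFactorial (Nat.card (childSet o par v)) : ℕ) : ℝ) /
          (d : ℝ) ^ Nat.card (OddPart ht) =
      (∏ v : EvenPart ht, (d.descFactorial (Nat.card (childSet o par (v : α))) : ℝ) /
        (d : ℝ) ^ Nat.card (childSet o par (v : α))) *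
        (k.factorial : ℝ) ^ Nat.card (OddPart ht) := by
    intro d
    rw [← Fintype.prod_subtype_mul_prod_subtype (fun v => Even (ht v)), Finset.prod_div_distrib,
      Finset.prod_pow_eq_pow_sum, sum_card_childSet_even hT]
    have h1 : ∏ v : {v // Even (ht v)}, (if Even (ht (v : α)) then d else k).descFactorial
        (Nat.card (childSet o par (v : α))) =
        ∏ v : EvenPart ht, d.descFactorial (Nat.card (childSet o par (v : α))) :=
      Finset.prod_congr rfl fun v _ => by rw [if_pos v.2]
    have h2 : ∏ v : {v // ¬ Even (ht v)}, (if Even (ht (v : α)) then d else k).descFactorial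
        (Nat.card (childSet o par (v : α))) = k.factorial ^ Nat.card (OddPart ht) := by
      rw [Finset.prod_congr rfl fun v _ => show _ = k.factorial by
        rw [if_neg v.2, hodd v (Nat.not_even_iff_odd.1 v.2), Nat.descFactorial_self],
        Finset.prod_const, Finset.card_univ, ← Nat.card_eq_fintype_card]
      congr 1
      exact Nat.card_congr (Equiv.subtypeEquivRight fun v => Nat.not_even_iff_odd)
    rw [h1, h2]
    push_cast
    ring
  simp only [hsplit]
  have := (tendsto_finsetProd (Finset.univ : Finset (EvenPart ht)) fun v _ =>
    tendsto_descFactorial_div_pow (Nat.card (childSet o par (v : α)))).mul_const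
    ((k.factorial : ℝ) ^ Nat.card (OddPart ht))
  simpa using this

end Limits

theorem tendsto_oneOutBallProb {α : Type*} [Fintype α] {k : ℕ} {T : SimpleGraph α} {o : α}
    (hT : IsValid k T o) :
    Tendsto (fun d : ℕ => oneOutBallProb k (d + 1) (height T o) T o) atTop
      (𝓝 (ballFormula k T o)) := by
  classical
  obtain ⟨par, hpar⟩ := exists_isRooted hT.isTree o
  have hr := dist_le_height T o
  have hodd := hT.card_childSet hpar
  -- The factor `d^{|U|}` divides the number of embeddings and multiplies the sum over patterns, so
  -- it cancels in the product.
  have hlim := ((tendsto_card_bigMaps_div_pow hpar hodd).mul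
    ((tendsto_one_sub_inv_pow (Nat.card {v : EvenPart (T.dist o) // T.dist o v < height T o})
      (Nat.card (OddPart (T.dist o))) k).mul
    (tendsto_pow_mul_sum_coverings hpar hr hT.even_height))).div_const (numAut T o : ℝ)
  have hval : (k.factorial : ℝ) ^ Nat.card (OddPart (T.dist o)) *
      (Real.exp (-((k : ℝ) *
        (Nat.card {v : EvenPart (T.dist o) // T.dist o v < height T o} : ℝ))) *
      ({M : T.Subgraph | M.IsMatching ∧ {v | T.dist o v < height T o} ⊆ M.verts}.ncard : ℝ)) /
      (numAut T o : ℝ) = ballFormula k T o := by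
    have h1 : Nat.card (OddPart (T.dist o)) = (oddVerts T o).ncard :=
      Nat.card_coe_set_eq (oddVerts T o)
    have h2 : Nat.card {v : EvenPart (T.dist o) // T.dist o v < height T o} =
        (innerEvenVerts T o).ncard := by
      rw [← Nat.card_coe_set_eq]
      exact Nat.card_congr (Equiv.subtypeSubtypeEquivSubtypeInter
        (fun v => Even (T.dist o v)) (fun v => T.dist o v < height T o))
    rw [ballFormula, numMatchings, hT.innerEven_union_odd, h1, h2]
    ring
  rw [hval] at hlim
  refine (hlim.comp (tendsto_add_atTop_nat 1)).congr' ?_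
  filter_upwards [eventually_ge_atTop (Fintype.card α)] with d hd
  have h := numAut_mul_oneOutBallProb (d := d + 1) hpar hr hodd (by omega)
  have h0 : (numAut T o : ℝ) ≠ 0 := by exact_mod_cast (numAut_pos T o).ne'
  have hd0 : ((d + 1 : ℕ) : ℝ) ^ Nat.card (OddPart (T.dist o)) ≠ 0 := by positivity
  rw [Function.comp_apply, div_eq_iff h0, mul_comm (oneOutBallProb _ _ _ _ _), h, div_mul_eq_mul_div,
    div_eq_iff hd0]
  ring

end LocalLimit

theorem lemma1p5 {α : Type*} [Fintype α] (k : ℕ) (hk : 1 ≤ k)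
    (T : SimpleGraph α) (o : α) (hT : LocalLimit.IsValid k T o)
    (r : ℕ) (hr : LocalLimit.height T o = r) :
    Tendsto (fun d : ℕ => LocalLimit.oneOutBallProb k (d + 1) r T o) atTop
        (𝓝 (LocalLimit.branchingBallProb k r T o)) ∧
      Tendsto (fun d : ℕ => LocalLimit.oneOutBallProb k (d + 1) r T o) atTop
        (𝓝 (LocalLimit.ballFormula k T o)) ∧
      LocalLimit.branchingBallProb k r T o = LocalLimit.ballFormula k T o := by
  subst hr
  have hlim := LocalLimit.tendsto_oneOutBallProb hT
  have heq := LocalLimit.branchingBallProb_eq_ballFormula hk hT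
  exact ⟨heq ▸ hlim, hlim, heq⟩
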